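/- Let $K\ge 2$ and consider best-arm identification with $K$ arms whose reward distributions belong to a canonical one-parameter exponential family $P_\eta(dy)\propto e^{\eta y}\rho(dy)$, with natural parameters in the interior of the natural parameter space, parameterized by their means. Let $\theta_1,\dots,\theta_K$ be the mean rewards, let $I^*$ be the unique best arm ($\theta_x<\theta_{I^*}$ for all $x\ne I^*$), let $\mathcal X=[K]\setminus\{I^*\}$, and let $\mathrm{KL}(a\Vert c)$ be the Kullback--Leibler divergence between the members with means $a$ and $c$. For $\bm p\in\mathbb R^K_{\ge0}$ and $\bm\mu\in\mathbb R^{\mathcal X}$ put $$D(\bm p,x)=\inf_{\lambda\in[\theta_x,\theta_{I^*}]}\bigl\{p_{I^*}\mathrm{KL}(\theta_{I^*}\Vert\lambda)+p_x\mathrm{KL}(\theta_x\Vert\lambda)\bigr\},\qquad F(\bm p,\bm\mu)=\sum_{x\in\mathcal X}\mu_xD(\bm p,x).$$ Let $\Delta_K$ and $\Delta_{\mathcal X}$ be the probability simplices, let $\mathcal D_F\subseteq\Delta_K\times\Delta_{\mathcal X}$ be the set of points at which $F$ is differentiable (as a function on $\mathbb R^K_{\ge0}\times\mathbb R^{\mathcal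 X}$), and let $$\partial^\circ_{\bm p}F(\bm p,\bm\mu)=\operatorname{conv}\bigl\{\lim_n\nabla_{\bm p}F(\bm p^n,\bm\mu^n):(\bm p^n,\bm\mu^n)\in\mathcal D_F,\ (\bm p^n,\bm\mu^n)\to(\bm p,\bm\mu)\bigr\}$$ be the Clarke generalized gradient. Define $$\mathrm{LMO}_{\bm p}(\bm p,\bm\mu)=\operatorname{conv}\bigl\{\bm q\in\Delta_K:\exists\,\bm f\in\partial^\circ_{\bm p}F(\bm p,\bm\mu),\ \bm q\in\operatorname{argmax}_{\bm q'\in\Delta_K}\bm q'^\top\bm f\bigr\},\qquad \mathrm{LMO}_{\bm\mu}(\bm p,\bm\mu)=\operatorname{argmin}_{\bm\nu\in\Delta_{\mathcal X}}\bm\nu^\top\nabla_{\bm\mu}F(\bm p,\bm\mu).$$ A solution is a pair $(\bm p,\bm\mu)$ of functions on $[0,\infty)$, absolutely continuous on compact intervals, with arbitrary $(\bm p(0),\bm\mu(0))\in\Delta_K\times\Delta_{\mathcal X}$ (boundary points included) and, for almost every $t\ge0$, $$\dot{\bm p}(t)\in\mathrm{LMO}_{\bm p}(\bm p(t),\bm\mu(t))-\bm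 p(t),\qquad \dot{\bm\mu}(t)\in\mathrm{LMO}_{\bm\mu}(\bm p(t),\bm\mu(t))-\bm\mu(t).$$ (1) There is a finite $M_p$ such that $\|\nabla_{\bm p}D(\bm p,x)\|_\infty\le M_p$ for all $x\in\mathcal X$ and all $\bm p\in\Delta_K$ at which $D(\cdot,x)$ is differentiable. For every such $M_p$ let $$\kappa_{\min}=\min_{x\in\mathcal X}\ \inf_{\lambda\in[\theta_x,\theta_{I^*}]}\max\{\mathrm{KL}(\theta_x\Vert\lambda),\mathrm{KL}(\theta_{I^*}\Vert\lambda)\},\quad \varepsilon_0=\min\Bigl\{\tfrac12,\frac{\kappa_{\min}}{4KM_p}\Bigr\},\quad T^*=(K-1)\bigl(\log(1/\varepsilon_0)+\log2\bigr).$$ Then for every solution and every $t>T^*$, $\bm p(t)$ lies in the relative interior of $\Delta_K$, and $F$ is differentiable at $(\bm p(t),\bm\mu(t))$. (2) The game value converges uniformly over all solutions: there is a Nash equilibrium $(\bm p^*,\bm\mu^*)$ of the zero-sum game with payoff $F$ on $\Delta_K\times\Delta_{\mathcal X}$ ($\bm p$ maximizes, $\bm\mu$ minimizes) such that, with $F^*=F(\bm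 p^*,\bm\mu^*)$, for every $\varepsilon>0$ there is $T$ with $|F(\bm p(t),\bm\mu(t))-F^*|\le\varepsilon$ for every solution and every $t\ge T$. -/

import Mathlib

noncomputable section

namespace FWSP

open MeasureTheory Filter Topology Set ProbabilityTheory

/-! ### Concave-convex games on a product of simplices and their Frank-Wolfe dynamics -/

section Game

variable {ι κ : Type} [Fintype ι] [DecidableEq ι] [Fintype κ] [DecidableEq κ]

/-- The nonnegative orthant. -/
def orthant (ι : Type) : Set (ι → ℝ) := {p | ∀ i, 0 ≤ p i}

/-- The points of the product of the two simplices at which the payoff `F`, as a function on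
its domain (nonnegative orthant in `p`, whole space in `μ`), is differentiable. -/
def diffSet (F : (ι → ℝ) × (κ → ℝ) → ℝ) : Set ((ι → ℝ) × (κ → ℝ)) :=
  {z | z.1 ∈ stdSimplex ℝ ι ∧ z.2 ∈ stdSimplex ℝ κ ∧
    DifferentiableWithinAt ℝ F (orthant ι ×ˢ univ) z}

/-- The gradient of `F` in the first variable. -/
def gradP (F : (ι → ℝ) × (κ → ℝ) → ℝ) (z : (ι → ℝ) × (κ → ℝ)) : ι → ℝ :=
  fun i => fderivWithin ℝ F (orthant ι ×ˢ univ) z (Pi.single i 1, 0)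

/-- The gradient of `F` in the second variable. -/
def gradMu (F : (ι → ℝ) × (κ → ℝ) → ℝ) (z : (ι → ℝ) × (κ → ℝ)) : κ → ℝ :=
  fun x => fderiv ℝ (fun μ => F (z.1, μ)) z.2 (Pi.single x 1)

/-- The Clarke generalized gradient in the first variable: the convex hull of all limits of
gradients along sequences of differentiability points converging to `z`. -/
def clarkeP (F : (ι → ℝ) × (κ → ℝ) → ℝ) (z : (ι → ℝ) × (κ → ℝ)) : Set (ι → ℝ) :=
  convexHull ℝ {f | ∃ u : ℕ → (ι → ℝ) × (κ → ℝ), (∀ n, u n ∈ diffSet F) ∧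
    Tendsto u atTop (𝓝 z) ∧ Tendsto (fun n => gradP F (u n)) atTop (𝓝 f)}

/-- Linear maximization oracle of the first player. -/
def LMOp (F : (ι → ℝ) × (κ → ℝ) → ℝ) (z : (ι → ℝ) × (κ → ℝ)) : Set (ι → ℝ) :=
  convexHull ℝ {q | q ∈ stdSimplex ℝ ι ∧
    ∃ f ∈ clarkeP F z, ∀ q' ∈ stdSimplex ℝ ι, q' ⬝ᵥ f ≤ q ⬝ᵥ f}

/-- Linear minimization oracle of the second player. -/
def LMOmu (F : (ι → ℝ) × (κ → ℝ) → ℝ) (z : (ι → ℝ) × (κ → ℝ)) : Set (κ → ℝ) :=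
  {ν | ν ∈ stdSimplex ℝ κ ∧ ∀ ν' ∈ stdSimplex ℝ κ, ν ⬝ᵥ gradMu F z ≤ ν' ⬝ᵥ gradMu F z}

/-- `(p, μ)` is a solution on `[0, ∞)` of the differential inclusion
`p' ∈ LMOp (p, μ) - p`, `μ' ∈ LMOmu (p, μ) - μ` with some initial condition in the product of
the closed simplices: it is absolutely continuous on compact intervals and satisfies the
inclusion at almost every time. -/
structure IsSolution (F : (ι → ℝ) × (κ → ℝ) → ℝ) (p : ℝ → ι → ℝ) (μ : ℝ → κ → ℝ) : Prop where
  ac_p : ∀ T : ℝ, 0 ≤ T → AbsolutelyContinuousOnInterval p 0 T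
  ac_mu : ∀ T : ℝ, 0 ≤ T → AbsolutelyContinuousOnInterval μ 0 T
  init_p : p 0 ∈ stdSimplex ℝ ι
  init_mu : μ 0 ∈ stdSimplex ℝ κ
  deriv_p : ∀ᵐ t ∂(volume.restrict (Ici (0 : ℝ))),
    ∃ q ∈ LMOp F (p t, μ t), HasDerivAt p (q - p t) t
  deriv_mu : ∀ᵐ t ∂(volume.restrict (Ici (0 : ℝ))),
    ∃ ν ∈ LMOmu F (p t, μ t), HasDerivAt μ (ν - μ t) t

/-- Nash equilibrium of the zero-sum game in which `p` maximizes and `μ` minimizes `F`. -/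
def IsNash (F : (ι → ℝ) × (κ → ℝ) → ℝ) (ps : ι → ℝ) (μs : κ → ℝ) : Prop :=
  ps ∈ stdSimplex ℝ ι ∧ μs ∈ stdSimplex ℝ κ ∧
    (∀ p ∈ stdSimplex ℝ ι, F (p, μs) ≤ F (ps, μs)) ∧
    (∀ μ ∈ stdSimplex ℝ κ, F (ps, μs) ≤ F (ps, μ))

end Game

/-! ### Canonical one-parameter exponential families, parameterized by the mean -/

/-- The interior of the natural parameter space `{η | ∫ exp (η y) ρ(dy) < ∞}` of the
exponential family generated by `ρ`. -/
def natSpace (ρ : Measure ℝ) : Set ℝ := interior (integrableExpSet id ρ)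

/-- The member `exp (η y) ρ(dy) / ∫ exp (η y) ρ(dy)` with natural parameter `η`. -/
def natMember (ρ : Measure ℝ) (η : ℝ) : Measure ℝ := ρ.tilted (fun y => η * y)

/-- The mean of the member with natural parameter `η`. -/
def meanOf (ρ : Measure ℝ) (η : ℝ) : ℝ := ∫ y, y ∂(natMember ρ η)

/-- The mean parameter space. -/
def meanSpace (ρ : Measure ℝ) : Set ℝ := meanOf ρ '' natSpace ρ

/-- The member with mean `m`, for `m` in the mean parameter space. -/
def member (ρ : Measure ℝ) (m : ℝ) : Measure ℝ :=
  natMember ρ (Function.invFunOn (meanOf ρ) (natSpace ρ) m)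

/-- Kullback-Leibler divergence between the members with means `a` and `c`. -/
def KL (ρ : Measure ℝ) (a c : ℝ) : ℝ :=
  (InformationTheory.klDiv (member ρ a) (member ρ c)).toReal

/-! ### Best-arm identification -/

section BAI

variable {K : ℕ}

/-- The scenarios: all arms but the best arm `b`. -/
abbrev Scenario (b : Fin K) : Type := {x : Fin K // x ≠ b}

/-- The payoff in scenario `x`. -/
def D (ρ : Measure ℝ) (θ : Fin K → ℝ) (b : Fin K) (p : Fin K → ℝ) (x : Scenario b) : ℝ :=
  sInf ((fun l => p b * KL ρ (θ b) l + p x * KL ρ (θ x) l) '' Icc (θ x) (θ b))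

/-- The mixed payoff. -/
def payoff (ρ : Measure ℝ) (θ : Fin K → ℝ) (b : Fin K)
    (z : (Fin K → ℝ) × (Scenario b → ℝ)) : ℝ :=
  ∑ x, z.2 x * D ρ θ b z.1 x

/-- `M` bounds the sup-norm of the gradients of all `D(·, x)` at their differentiability points
in the simplex. -/
def IsGradBound (ρ : Measure ℝ) (θ : Fin K → ℝ) (b : Fin K) (M : ℝ) : Prop :=
  ∀ x : Scenario b, ∀ p ∈ stdSimplex ℝ (Fin K),
    DifferentiableWithinAt ℝ (fun p' => D ρ θ b p' x) (orthant (Fin K)) p →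
    ∀ i, |fderivWithin ℝ (fun p' => D ρ θ b p' x) (orthant (Fin K)) p (Pi.single i 1)| ≤ M

/-- The constant `κ_x`. -/
def kappa (ρ : Measure ℝ) (θ : Fin K → ℝ) (b : Fin K) (x : Scenario b) : ℝ :=
  sInf ((fun l => max (KL ρ (θ x) l) (KL ρ (θ b) l)) '' Icc (θ x) (θ b))

/-- The constant `κ_min`, the minimum of the `κ_x`. -/
def kappaMin (ρ : Measure ℝ) (θ : Fin K → ℝ) (b : Fin K) : ℝ :=
  ⨅ x : Scenario b, kappa ρ θ b x

/-- The constant `ε₀`, for the gradient bound `M`. -/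
def eps0 (ρ : Measure ℝ) (θ : Fin K → ℝ) (b : Fin K) (M : ℝ) : ℝ :=
  min (1 / 2) (kappaMin ρ θ b / (4 * (K : ℝ) * M))

/-- The entry time `T*`, for the gradient bound `M`. -/
def Tstar (ρ : Measure ℝ) (θ : Fin K → ℝ) (b : Fin K) (M : ℝ) : ℝ :=
  ((K : ℝ) - 1) * (Real.log (1 / eps0 ρ θ b M) + Real.log 2)

end BAI

end FWSP

end

/-!
By the compensation identity for the Kullback-Leibler divergence, the infimum defining `D p x` is
attained at the weighted average of `θ b` and `θ x`, so that `D · x` is a minimum of linear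
functionals; a selection of active ones is a supergradient, hence the derivative wherever it is
continuous, that is, wherever `p b + p x > 0`.

The best arm is played at every positive time: without it the gradients of all played arms vanish,
while the entries of every generalized gradient sum to at least `κ_min`. If the set of unplayed
arms were nonempty and constant for longer than `log (1 / ε₀)`, then `μ`, which only moves towards
unplayed arms, would give the played ones mass at most `ε₀`, and an unplayed arm would be the
strictly best response. The decreasing set of unplayed arms takes at most `K - 1` nonempty values,
so it is empty after `T*`.

Finally let `V` be the gap between the best response of `p` to the linearized payoff and that of
`μ`. It bounds the distance from the payoff to the value of the game. The best responses chosen at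
a given time, kept fixed, give a differentiable minorant of `V` touching it at that time. Its
derivative is at most `-V`: the second derivative of `D · x` at `p` is nonpositive and vanishes
in the direction `p`, because `D · x` is concave and homogeneous. So `V` decays exponentially,
at a rate independent of the solution.
-/

noncomputable section

namespace FWSP

open MeasureTheory Filter Topology Set ProbabilityTheory

/-! ### Differentiability within a set -/

section Calculus

variable {E : Type*} [NormedAddCommGroup E] [NormedSpace ℝ E] {f : E → ℝ} {s : Set E} {z d : E}

lemma hasFDerivWithinAt_of_supergradient {L : E → E →L[ℝ] ℝ}
    (hL : ∀ y ∈ s, ∀ w ∈ s, f w ≤ f y + L y (w - y)) (hz : z ∈ s)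
    (hcont : ContinuousWithinAt L s z) : HasFDerivWithinAt f (L z) s z := by
  rw [hasFDerivWithinAt_iff_isLittleO, Asymptotics.isLittleO_iff]
  intro ε hε
  filter_upwards [hcont.eventually (Metric.closedBall_mem_nhds _ hε), self_mem_nhdsWithin]
    with w hw hws
  have hupper := hL z hz w hws
  have hlower := hL w hws z hz
  have hLw : |(L w - L z) (w - z)| ≤ ε * ‖w - z‖ :=
    ((L w - L z).le_opNorm _).trans (by rw [← dist_eq_norm]; gcongr)
  rw [← neg_sub w z, map_neg] at hlower
  rw [sub_apply] at hLw
  rw [Real.norm_eq_abs, abs_le]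
  constructor <;> linarith [abs_le.1 hLw]

lemma fderivWithin_apply_eq_of_ray {c : ℝ} (hf : DifferentiableWithinAt ℝ f s z)
    (hmem : ∀ t : ℝ, 0 ≤ t → z + t • d ∈ s)
    (hray : HasDerivWithinAt (fun t : ℝ => f (z + t • d)) c (Ici 0) 0) :
    fderivWithin ℝ f s z d = c := by
  have hline : HasDerivWithinAt (fun t : ℝ => z + t • d) d (Ici 0) 0 := by
    simpa using (((hasDerivAt_id (0 : ℝ)).smul_const d).const_add z).hasDerivWithinAt
  have hf' : HasFDerivWithinAt f (fderivWithin ℝ f s z) s (z + (0 : ℝ) • d) := by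
    simpa using hf.hasFDerivWithinAt
  exact (uniqueDiffOn_Ici (0 : ℝ) 0 self_mem_Ici).eq_deriv _
    (hf'.comp_hasDerivWithinAt (0 : ℝ) hline fun t ht => hmem t ht) hray

end Calculus

/-! ### Simplices and orthants -/

section Simplex

variable {ι : Type*} [Fintype ι] {f q : ι → ℝ} {c : ℝ}

lemma dotProduct_le_of_forall_le (hq : q ∈ stdSimplex ℝ ι) (hf : ∀ i, f i ≤ c) : q ⬝ᵥ f ≤ c := by
  calc q ⬝ᵥ f ≤ ∑ i, q i * c :=
        Finset.sum_le_sum fun i _ => mul_le_mul_of_nonneg_left (hf i) (hq.1 i)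
    _ = c := by rw [← Finset.sum_mul, hq.2, one_mul]

lemma le_dotProduct_of_forall_le (hq : q ∈ stdSimplex ℝ ι) (hf : ∀ i, c ≤ f i) : c ≤ q ⬝ᵥ f := by
  have hneg := dotProduct_le_of_forall_le (f := -f) hq fun i => neg_le_neg (hf i)
  rwa [dotProduct_neg, neg_le_neg_iff] at hneg

lemma dotProduct_le_iSup (hq : q ∈ stdSimplex ℝ ι) : q ⬝ᵥ f ≤ ⨆ i, f i :=
  dotProduct_le_of_forall_le hq (le_ciSup (finite_range f).bddAbove)

lemma iInf_le_dotProduct (hq : q ∈ stdSimplex ℝ ι) : ⨅ i, f i ≤ q ⬝ᵥ f :=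
  le_dotProduct_of_forall_le hq (ciInf_le (finite_range f).bddBelow)

lemma eq_zero_of_forall_le_dotProduct (hq : q ∈ stdSimplex ℝ ι) (hmax : ∀ j, f j ≤ q ⬝ᵥ f)
    {i j : ι} (hij : f i < f j) : q i = 0 := by
  have hsum : ∑ k, q k * (q ⬝ᵥ f - f k) = 0 := by
    simp_rw [mul_sub]
    rw [Finset.sum_sub_distrib, ← Finset.sum_mul, hq.2, one_mul, dotProduct, sub_self]
  have hterm := (Finset.sum_eq_zero_iff_of_nonneg fun k _ =>
    mul_nonneg (hq.1 k) (sub_nonneg.2 (hmax k))).1 hsum i (Finset.mem_univ i)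
  exact (mul_eq_zero.1 hterm).resolve_right (sub_pos.2 (hij.trans_le (hmax j))).ne'

lemma sum_eq_one_of_mem_affineSpan_stdSimplex (hq : q ∈ affineSpan ℝ (stdSimplex ℝ ι)) :
    ∑ i, q i = 1 := by
  refine affineSpan_induction (p := fun q : ι → ℝ => ∑ i, q i = 1) hq (fun z hz => hz.2) ?_
  intro c u v w hu hv hw
  simp only [vsub_eq_sub, vadd_eq_add, Pi.add_apply, Pi.smul_apply, Pi.sub_apply, smul_eq_mul,
    Finset.sum_add_distrib, ← Finset.mul_sum, Finset.sum_sub_distrib, hu, hv, hw]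
  ring

lemma mem_intrinsicInterior_stdSimplex (hq : q ∈ stdSimplex ℝ ι) (hpos : ∀ i, 0 < q i) :
    q ∈ intrinsicInterior ℝ (stdSimplex ℝ ι) := by
  refine mem_intrinsicInterior.2 ⟨⟨q, subset_affineSpan ℝ _ hq⟩, mem_interior.2
    ⟨{y | ∀ i, 0 < (y : ι → ℝ) i}, fun y hy => ?_, ?_, hpos⟩, rfl⟩
  · exact ⟨fun i => (hy i).le, sum_eq_one_of_mem_affineSpan_stdSimplex y.2⟩
  · simp only [ofPred_forall]
    exact isOpen_iInter_of_finite fun i =>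
      isOpen_lt continuous_const ((continuous_apply i).comp continuous_subtype_val)

end Simplex

section Orthant

variable {ι : Type} {p d : ι → ℝ}

lemma orthant_eq_pi : orthant ι = univ.pi fun _ => Ici 0 := by
  ext p
  simp only [orthant, mem_ofPred_eq, Set.mem_pi, mem_univ, true_implies, mem_Ici]

lemma convex_orthant : Convex ℝ (orthant ι) := by
  rw [orthant_eq_pi]
  exact convex_pi fun _ _ => convex_Ici 0

lemma add_smul_mem_orthant (hp : p ∈ orthant ι) (hd : d ∈ orthant ι) {t : ℝ} (ht : 0 ≤ t) :
    p + t • d ∈ orthant ι :=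
  fun i => add_nonneg (hp i) (mul_nonneg ht (hd i))

lemma single_mem_orthant [DecidableEq ι] (i : ι) : (Pi.single i 1 : ι → ℝ) ∈ orthant ι :=
  fun j => by
    by_cases hj : j = i
    · simp [hj]
    · simp [hj]

lemma uniqueDiffOn_orthant [Finite ι] : UniqueDiffOn ℝ (orthant ι) := by
  rw [orthant_eq_pi]
  exact UniqueDiffOn.univ_pi fun _ => uniqueDiffOn_Ici 0

lemma orthant_mem_nhds [Finite ι] (hp : ∀ i, 0 < p i) : orthant ι ∈ 𝓝 p := by
  rw [orthant_eq_pi]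
  exact set_pi_mem_nhds finite_univ fun i _ => Ici_mem_nhds (hp i)

end Orthant

/-! ### Generalized gradients and oracles -/

section Oracles

variable {ι κ : Type} [Fintype κ] {F : (ι → ℝ) × (κ → ℝ) → ℝ} {z : (ι → ℝ) × (κ → ℝ)}

section

variable [Fintype ι] [DecidableEq ι] {f q : ι → ℝ}

lemma clarkeP_subset {C : Set (ι → ℝ)} (hconv : Convex ℝ C) (hclosed : IsClosed C)
    (hgrad : ∀ z' ∈ diffSet F, gradP F z' ∈ C) : clarkeP F z ⊆ C := by
  refine convexHull_min ?_ hconv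
  rintro f ⟨u, hu, -, hlim⟩
  exact hclosed.mem_of_tendsto hlim (Eventually.of_forall fun n => hgrad _ (hu n))

lemma apply_eq_of_mem_clarkeP {g : (ι → ℝ) × (κ → ℝ) → ι → ℝ}
    (hgrad : ∀ z' ∈ diffSet F, gradP F z' = g z') {i : ι}
    (hcont : ContinuousAt (fun z => g z i) z) (hf : f ∈ clarkeP F z) : f i = g z i := by
  have hconv : Convex ℝ {f : ι → ℝ | f i = g z i} :=
    convex_hyperplane (f := fun f : ι → ℝ => f i) ⟨fun _ _ => rfl, fun _ _ => rfl⟩ _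
  refine convexHull_min ?_ hconv hf
  rintro f ⟨u, hu, hz, hlim⟩
  simp_rw [fun n => hgrad _ (hu n)] at hlim
  exact tendsto_nhds_unique ((tendsto_pi_nhds.1 hlim) i) (hcont.tendsto.comp hz)

lemma LMOp_subset_stdSimplex : LMOp F z ⊆ stdSimplex ℝ ι :=
  convexHull_min (fun _ hq => hq.1) (convex_stdSimplex ℝ _)

lemma le_dotProduct_of_mem_LMOp (hf : clarkeP F z ⊆ {f}) (hq : q ∈ LMOp F z) (i : ι) :
    f i ≤ q ⬝ᵥ f := by
  have hconv : Convex ℝ {q : ι → ℝ | f i ≤ q ⬝ᵥ f} :=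
    convex_halfSpace_ge (f := fun q : ι → ℝ => q ⬝ᵥ f)
      ⟨fun _ _ => add_dotProduct _ _ _, fun _ _ => smul_dotProduct _ _ _⟩ _
  refine convexHull_min ?_ hconv hq
  rintro q ⟨_, f', hf', hmax⟩
  obtain rfl := hf hf'
  have hle := hmax _ (single_mem_stdSimplex ℝ i)
  rwa [single_one_dotProduct] at hle

lemma apply_eq_zero_of_mem_LMOp {i : ι} (hi : ∀ f ∈ clarkeP F z, ∃ j, f i < f j)
    (hq : q ∈ LMOp F z) : q i = 0 := by
  have hconv : Convex ℝ {q : ι → ℝ | q i = 0} :=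
    convex_hyperplane (f := fun q : ι → ℝ => q i) ⟨fun _ _ => rfl, fun _ _ => rfl⟩ 0
  refine convexHull_min ?_ hconv hq
  rintro q ⟨hqs, f, hf, hmax⟩
  obtain ⟨j, hij⟩ := hi f hf
  refine eq_zero_of_forall_le_dotProduct hqs (fun k => ?_) hij
  simpa only [single_one_dotProduct] using hmax _ (single_mem_stdSimplex ℝ k)

end

section

variable [DecidableEq κ] {ν : κ → ℝ}

lemma dotProduct_le_of_mem_LMOmu (hν : ν ∈ LMOmu F z) (x : κ) :
    ν ⬝ᵥ gradMu F z ≤ gradMu F z x := by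
  simpa only [single_one_dotProduct] using hν.2 _ (single_mem_stdSimplex ℝ x)

lemma apply_eq_zero_of_mem_LMOmu (hν : ν ∈ LMOmu F z) {x y : κ}
    (hxy : gradMu F z x < gradMu F z y) : ν y = 0 := by
  refine eq_zero_of_forall_le_dotProduct (f := -gradMu F z) (j := x) hν.1 (fun k => ?_)
    (neg_lt_neg hxy)
  rw [dotProduct_neg]
  exact neg_le_neg (dotProduct_le_of_mem_LMOmu hν k)

end

end Oracles

/-! ### Absolutely continuous functions -/

section AbsolutelyContinuous

variable {s t : ℝ}

lemma absolutelyContinuousOnInterval_of_dist_le {ι X Y : Type*} [Fintype ι]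
    [PseudoMetricSpace X] [PseudoMetricSpace Y] {f : ι → ℝ → X} {g : ℝ → Y} {C : ℝ}
    (hf : ∀ i, AbsolutelyContinuousOnInterval (f i) s t)
    (hle : ∀ r ∈ uIcc s t, ∀ r' ∈ uIcc s t, dist (g r) (g r') ≤ C * ∑ i, dist (f i r) (f i r')) :
    AbsolutelyContinuousOnInterval g s t := by
  have hlim := (tendsto_finsetSum Finset.univ fun i _ => hf i).const_mul C
  rw [Finset.sum_const_zero, mul_zero] at hlim
  refine squeeze_zero' (Eventually.of_forall fun E => Finset.sum_nonneg fun _ _ => dist_nonneg)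
    ?_ hlim
  filter_upwards [mem_inf_of_right (mem_principal_self _)] with E hE
  rw [Finset.sum_comm, Finset.mul_sum]
  exact Finset.sum_le_sum fun j hj => hle _ (hE.1 j hj).1 _ (hE.1 j hj).2

lemma absolutelyContinuousOnInterval_const {X : Type*} [PseudoMetricSpace X] (c : X) :
    AbsolutelyContinuousOnInterval (fun _ => c) s t :=
  ((LipschitzWith.const c).lipschitzOnWith (s := uIcc s t)).absolutelyContinuousOnInterval

lemma absolutelyContinuousOnInterval_apply {ι : Type*} [Fintype ι] {y : ℝ → ι → ℝ}
    (hy : AbsolutelyContinuousOnInterval y s t) (i : ι) :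
    AbsolutelyContinuousOnInterval (fun r => y r i) s t := by
  refine absolutelyContinuousOnInterval_of_dist_le (f := fun _ : Unit => y) (C := 1)
    (fun _ => hy) fun r _ r' _ => ?_
  simpa using dist_le_pi_dist (y r) (y r') i

lemma absolutelyContinuousOnInterval_sum {ι : Type*} {S : Finset ι} {f : ι → ℝ → ℝ}
    (hf : ∀ i ∈ S, AbsolutelyContinuousOnInterval (f i) s t) :
    AbsolutelyContinuousOnInterval (fun r => ∑ i ∈ S, f i r) s t := by
  refine absolutelyContinuousOnInterval_of_dist_le (f := fun i : S => f i) (C := 1)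
    (fun i => hf i i.2) fun r _ r' _ => ?_
  rw [one_mul, Finset.sum_coe_sort S fun i => dist (f i r) (f i r')]
  exact dist_sum_sum_le _ _ _

lemma absolutelyContinuousOnInterval_iSup {ι : Type*} [Finite ι] [Nonempty ι] {f : ι → ℝ → ℝ}
    (hf : ∀ i, AbsolutelyContinuousOnInterval (f i) s t) :
    AbsolutelyContinuousOnInterval (fun r => ⨆ i, f i r) s t := by
  have := Fintype.ofFinite ι
  have hle (r r' : ℝ) : ⨆ i, f i r ≤ (⨆ i, f i r') + ∑ i, dist (f i r) (f i r') := by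
    refine ciSup_le fun i => ?_
    have hsup := le_ciSup (finite_range fun i => f i r').bddAbove i
    have hsum := Finset.single_le_sum (f := fun i => dist (f i r) (f i r'))
      (fun _ _ => dist_nonneg) (Finset.mem_univ i)
    have hdist := (le_abs_self _).trans_eq (Real.dist_eq (f i r) (f i r')).symm
    linarith
  refine absolutelyContinuousOnInterval_of_dist_le (C := 1) hf fun r _ r' _ => ?_
  have hle' := hle r' r
  simp only [dist_comm (f _ r')] at hle'
  rw [Real.dist_eq, abs_sub_le_iff]
  constructor <;> linarith [hle r r']

lemma absolutelyContinuousOnInterval_iInf {ι : Type*} [Finite ι] [Nonempty ι] {f : ι → ℝ → ℝ}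
    (hf : ∀ i, AbsolutelyContinuousOnInterval (f i) s t) :
    AbsolutelyContinuousOnInterval (fun r => ⨅ i, f i r) s t := by
  have hneg := (absolutelyContinuousOnInterval_iSup fun i => (hf i).neg).neg
  refine (congrArg (AbsolutelyContinuousOnInterval · s t) (funext fun r => ?_)).mpr hneg
  rw [iInf, Real.sInf_def, ← image_neg_eq_neg, ← range_comp]
  rfl

lemma absolutelyContinuousOnInterval_comp {f g g' : ℝ → ℝ}
    (hf : AbsolutelyContinuousOnInterval f s t) (hg : ∀ r ∈ uIcc s t, HasDerivAt g (g' (f r)) (f r))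
    (hg' : ContinuousOn g' (f '' uIcc s t)) :
    AbsolutelyContinuousOnInterval (fun r => g (f r)) s t := by
  obtain ⟨C, hC⟩ :=
    (isCompact_uIcc.image_of_continuousOn hf.continuousOn).exists_bound_of_continuousOn hg'
  have hconv : Convex ℝ (f '' uIcc s t) :=
    (isPreconnected_uIcc.image f hf.continuousOn).ordConnected.convex
  refine absolutelyContinuousOnInterval_of_dist_le (f := fun _ : Unit => f) (C := C)
    (fun _ => hf) fun r hr r' hr' => ?_
  have hlip := hconv.norm_image_sub_le_of_norm_hasDerivWithin_le (f := g) (f' := g') (C := C)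
    (forall_mem_image.2 fun r hr => (hg r hr).hasDerivWithinAt) hC (mem_image_of_mem f hr')
    (mem_image_of_mem f hr)
  simpa [dist_eq_norm] using hlip

lemma exists_mem_Ioo_of_ae {P : ℝ → Prop} (hP : ∀ᵐ r, P r) (hst : s < t) : ∃ r ∈ Ioo s t, P r := by
  obtain ⟨r, hr, hPr⟩ :=
    (Measure.dense_of_ae hP).exists_mem_open isOpen_Ioo (nonempty_Ioo.2 hst)
  exact ⟨r, hPr, hr⟩

lemma le_exp_mul_of_deriv_le {w : ℝ → ℝ} (hst : s ≤ t)
    (hw : AbsolutelyContinuousOnInterval w s t)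
    (hderiv : ∀ᵐ r, r ∈ Ioo s t → ∃ c ≤ -w r, HasDerivAt w c r) :
    w t ≤ Real.exp (-(t - s)) * w s := by
  have hexp : AbsolutelyContinuousOnInterval Real.exp s t :=
    Real.contDiff_exp.contDiffOn.absolutelyContinuousOnInterval
  have hdecr : ∫ r in s..t, deriv (fun r => Real.exp r * w r) r ≤ 0 := by
    rw [intervalIntegral.integral_of_le hst, integral_Ioc_eq_integral_Ioo]
    refine setIntegral_nonpos_ae measurableSet_Ioo (hderiv.mono fun r hr hmem => ?_)
    obtain ⟨c, hle, hc⟩ := hr hmem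
    rw [((Real.hasDerivAt_exp r).fun_mul hc).deriv, ← mul_add]
    exact mul_nonpos_of_nonneg_of_nonpos (Real.exp_pos r).le (by linarith)
  rw [(hexp.fun_mul hw).integral_deriv_eq_sub, sub_nonpos] at hdecr
  calc w t = Real.exp (-t) * (Real.exp t * w t) := by
        rw [← mul_assoc, ← Real.exp_add, neg_add_cancel, Real.exp_zero, one_mul]
    _ ≤ Real.exp (-t) * (Real.exp s * w s) := by gcongr
    _ = Real.exp (-(t - s)) * w s := by
        rw [← mul_assoc, ← Real.exp_add, neg_sub, sub_eq_neg_add]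

-- A minorant touching a differentiable function from below has the same derivative there.
lemma le_exp_mul_of_touching_deriv_le {V : ℝ → ℝ} (hst : s ≤ t)
    (hV : AbsolutelyContinuousOnInterval V s t)
    (htouch : ∀ᵐ r, r ∈ Ioo s t →
      ∃ W : ℝ → ℝ, W ≤ V ∧ W r = V r ∧ ∃ c ≤ -V r, HasDerivAt W c r) :
    V t ≤ Real.exp (-(t - s)) * V s := by
  refine le_exp_mul_of_deriv_le hst hV ?_
  filter_upwards [hV.ae_differentiableAt, htouch] with r hdiff hr hmem
  obtain ⟨W, hWV, heq, c, hle, hW⟩ := hr hmem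
  have hVr := (hdiff ((uIcc_of_le hst).symm ▸ Ioo_subset_Icc_self hmem)).hasDerivAt
  have hmin : IsLocalMin (fun r => V r - W r) r := by
    refine Eventually.of_forall fun r' => ?_
    change V r - W r ≤ V r' - W r'
    rw [heq, sub_self]
    exact sub_nonneg.2 (hWV r')
  have hzero := hmin.hasDerivAt_eq_zero (hVr.fun_sub hW)
  exact ⟨c, hle, sub_eq_zero.1 hzero ▸ hVr⟩

end AbsolutelyContinuous

/-! ### Relaxation towards moving targets in a simplex -/

section Relaxation

variable {ι : Type*}

lemma target_apply_eq_zero [Finite ι] {y : ℝ → ι → ℝ} {q : ι → ℝ} {r s t : ℝ}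
    (hderiv : HasDerivAt y (q - y r) r) (hr : r ∈ Ioo s t) {i : ι}
    (hzero : ∀ r ∈ Ioo s t, y r i = 0) : q i = 0 := by
  have := Fintype.ofFinite ι
  have hconst : HasDerivAt (fun r => y r i) 0 r := by
    refine (hasDerivAt_const r (0 : ℝ)).congr_of_eventuallyEq ?_
    filter_upwards [isOpen_Ioo.mem_nhds hr] with r' hr' using hzero r' hr'
  have heq := (hasDerivAt_pi.1 hderiv i).unique hconst
  rwa [Pi.sub_apply, hzero r hr, sub_zero] at heq

variable [Fintype ι]

/-- A curve that starts in the simplex and moves at almost every time towards a point of the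
simplex, at a speed equal to the displacement; both components of a solution are of this kind. -/
structure IsRelaxation (y : ℝ → ι → ℝ) : Prop where
  ac : ∀ T : ℝ, 0 ≤ T → AbsolutelyContinuousOnInterval y 0 T
  start : y 0 ∈ stdSimplex ℝ ι
  deriv : ∀ᵐ r : ℝ, 0 ≤ r → ∃ q ∈ stdSimplex ℝ ι, HasDerivAt y (q - y r) r

namespace IsRelaxation

variable {y : ℝ → ι → ℝ} {s t : ℝ}

lemma ac_Icc (hy : IsRelaxation y) (hs : 0 ≤ s) (hst : s ≤ t) :
    AbsolutelyContinuousOnInterval y s t := by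
  refine (hy.ac t (hs.trans hst)).mono ?_
  rw [uIcc_of_le hst, uIcc_of_le (hs.trans hst)]
  exact Icc_subset_Icc_left hs

lemma exp_mul_le (hy : IsRelaxation y) (hs : 0 ≤ s) (hst : s ≤ t) (i : ι) :
    Real.exp (-(t - s)) * y s i ≤ y t i := by
  have hneg : -y t i ≤ Real.exp (-(t - s)) * (-y s i) := by
    refine le_exp_mul_of_deriv_le (w := fun r => -y r i) hst
      (absolutelyContinuousOnInterval_apply (hy.ac_Icc hs hst) i).neg ?_
    filter_upwards [hy.deriv] with r hr hmem
    obtain ⟨q, hq, hderiv⟩ := hr (hs.trans hmem.1.le)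
    refine ⟨_, ?_, (hasDerivAt_pi.1 hderiv i).neg⟩
    rw [Pi.sub_apply]
    linarith [hq.1 i]
  linarith

lemma nonneg (hy : IsRelaxation y) (ht : 0 ≤ t) (i : ι) : 0 ≤ y t i :=
  (mul_nonneg (Real.exp_pos _).le (hy.start.1 i)).trans (hy.exp_mul_le le_rfl ht i)

lemma pos_of_pos (hy : IsRelaxation y) (hs : 0 ≤ s) (hst : s ≤ t) {i : ι} (hi : 0 < y s i) :
    0 < y t i :=
  (mul_pos (Real.exp_pos _) hi).trans_le (hy.exp_mul_le hs hst i)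

lemma eq_zero_of_eq_zero (hy : IsRelaxation y) (hs : 0 ≤ s) (hst : s ≤ t) {i : ι}
    (hi : y t i = 0) : y s i = 0 := by
  by_contra hne
  exact (hy.pos_of_pos hs hst ((hy.nonneg hs i).lt_of_ne' hne)).ne' hi

lemma ac_sum (hy : IsRelaxation y) (hs : 0 ≤ s) (hst : s ≤ t) (S : Finset ι) :
    AbsolutelyContinuousOnInterval (fun r => ∑ i ∈ S, y r i) s t :=
  absolutelyContinuousOnInterval_sum fun i _ =>
    absolutelyContinuousOnInterval_apply (hy.ac_Icc hs hst) i

lemma sum_eq_one (hy : IsRelaxation y) (ht : 0 ≤ t) : ∑ i, y t i = 1 := by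
  have hac : AbsolutelyContinuousOnInterval (fun r => ∑ i, y r i - 1) 0 t :=
    (hy.ac_sum le_rfl ht _).sub (absolutelyContinuousOnInterval_const 1)
  have hderiv : ∀ᵐ r, r ∈ Ioo 0 t →
      HasDerivAt (fun r => ∑ i, y r i - 1) (-(∑ i, y r i - 1)) r := by
    filter_upwards [hy.deriv] with r hr hmem
    obtain ⟨q, hq, hderiv⟩ := hr hmem.1.le
    refine ((HasDerivAt.fun_sum fun i (_ : i ∈ Finset.univ) =>
      hasDerivAt_pi.1 hderiv i).sub_const 1).congr_deriv ?_
    simp only [Pi.sub_apply, Finset.sum_sub_distrib, hq.2, neg_sub]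
  have hle := le_exp_mul_of_deriv_le ht hac (hderiv.mono fun r hr hmem => ⟨_, le_rfl, hr hmem⟩)
  have hge := le_exp_mul_of_deriv_le ht hac.neg
    (hderiv.mono fun r hr hmem => ⟨_, le_rfl, (hr hmem).neg⟩)
  simp only [Pi.neg_apply, hy.start.2, sub_self, mul_zero, neg_zero] at hle hge
  linarith

lemma mem_stdSimplex (hy : IsRelaxation y) (ht : 0 ≤ t) : y t ∈ stdSimplex ℝ ι :=
  ⟨hy.nonneg ht, hy.sum_eq_one ht⟩

lemma sum_le_exp_mul (hy : IsRelaxation y) (hs : 0 ≤ s) (hst : s ≤ t) {S : Finset ι}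
    (hderiv : ∀ᵐ r, r ∈ Ioo s t → ∃ q : ι → ℝ, (∀ i ∈ S, q i = 0) ∧ HasDerivAt y (q - y r) r) :
    ∑ i ∈ S, y t i ≤ Real.exp (-(t - s)) * ∑ i ∈ S, y s i := by
  refine le_exp_mul_of_deriv_le (w := fun r => ∑ i ∈ S, y r i) hst (hy.ac_sum hs hst S) ?_
  filter_upwards [hderiv] with r hr hmem
  obtain ⟨q, hq, hderiv⟩ := hr hmem
  refine ⟨_, le_of_eq ?_, HasDerivAt.fun_sum fun i _ => hasDerivAt_pi.1 hderiv i⟩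
  simp only [Pi.sub_apply, Finset.sum_sub_distrib, Finset.sum_eq_zero hq, zero_sub]

lemma exists_pos_before (hy : IsRelaxation y) (ht : 0 < t) :
    ∃ s ∈ Ioo 0 t, ∀ i, 0 < y t i → 0 < y s i := by
  have hcont : ContinuousWithinAt y (Ioo 0 t) t :=
    ((hy.ac t ht.le).continuousOn t right_mem_uIcc).mono
      (Ioo_subset_Icc_self.trans_eq (uIcc_of_le ht.le).symm)
  have hpos : ∀ᶠ s in 𝓝[Ioo 0 t] t, ∀ i, 0 < y t i → 0 < y s i :=
    eventually_all.2 fun i => eventually_imp_distrib_left.2 fun hi =>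
      (((continuous_apply i).tendsto _).comp hcont).eventually (lt_mem_nhds hi)
  have : (𝓝[Ioo 0 t] t).NeBot := by
    rw [nhdsWithin_Ioo_eq_nhdsLT ht]
    infer_instance
  obtain ⟨s, hs, hmem⟩ := (hpos.and self_mem_nhdsWithin).exists
  exact ⟨s, hmem, hs⟩

end IsRelaxation

end Relaxation

section Solution

variable {ι κ : Type} [Fintype ι] [DecidableEq ι] [Fintype κ] [DecidableEq κ]
  {F : (ι → ℝ) × (κ → ℝ) → ℝ} {p : ℝ → ι → ℝ} {μ : ℝ → κ → ℝ}

namespace IsSolution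

lemma ae_deriv_p (hsol : IsSolution F p μ) :
    ∀ᵐ r : ℝ, 0 ≤ r → ∃ q ∈ LMOp F (p r, μ r), HasDerivAt p (q - p r) r :=
  (ae_restrict_iff' measurableSet_Ici).1 hsol.deriv_p

lemma ae_deriv_mu (hsol : IsSolution F p μ) :
    ∀ᵐ r : ℝ, 0 ≤ r → ∃ ν ∈ LMOmu F (p r, μ r), HasDerivAt μ (ν - μ r) r :=
  (ae_restrict_iff' measurableSet_Ici).1 hsol.deriv_mu

lemma isRelaxation_p (hsol : IsSolution F p μ) : IsRelaxation p :=
  ⟨hsol.ac_p, hsol.init_p, hsol.ae_deriv_p.mono fun _ hr hr0 =>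
    (hr hr0).imp fun _ hq => ⟨LMOp_subset_stdSimplex hq.1, hq.2⟩⟩

lemma isRelaxation_mu (hsol : IsSolution F p μ) : IsRelaxation μ :=
  ⟨hsol.ac_mu, hsol.init_mu, hsol.ae_deriv_mu.mono fun _ hr hr0 =>
    (hr hr0).imp fun _ hν => ⟨hν.1.1, hν.2⟩⟩

end IsSolution

end Solution

/-! ### Antitone families of finite sets -/

section Antitone

variable {α : Type*} [Fintype α]

lemma exists_eq_succ_of_antitone {N : ℕ} {Z : ℕ → Finset α} (hZ : Antitone Z)
    (hne : (Z N).Nonempty) (hcard : Fintype.card α ≤ N) : ∃ j < N, Z (j + 1) = Z j := by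
  by_contra! hcon
  have hbound : ∀ j ≤ N, (Z j).card + j ≤ Fintype.card α := by
    intro j
    induction j with
    | zero => exact fun _ => Finset.card_le_univ _
    | succ j ih =>
      intro hj
      have hlt := Finset.card_lt_card ((hZ (Nat.le_add_right j 1)).ssubset_of_ne (hcon j hj))
      have hle := ih (Nat.le_of_succ_le hj)
      omega
  have hN := hbound N le_rfl
  have hpos := hne.card_pos
  omega

lemma le_card_mul_of_antitoneOn {Z : ℝ → Finset α} (hZ : AntitoneOn Z (Ici 0)) {L : ℝ}
    (hL : ∀ s e : ℝ, 0 ≤ s → s ≤ e → Z e = Z s → (Z e).Nonempty → e - s ≤ L) {t : ℝ}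
    (ht : 0 ≤ t) (hne : (Z t).Nonempty) : t ≤ Fintype.card α * L := by
  have hN : 0 < (Fintype.card α : ℝ) :=
    Nat.cast_pos.2 (Fintype.card_pos_iff.2 ⟨hne.choose⟩)
  set τ : ℕ → ℝ := fun j => j * (t / Fintype.card α)
  have hτ : Monotone τ := fun i j hij =>
    mul_le_mul_of_nonneg_right (Nat.cast_le.2 hij) (by positivity)
  have hτ_nonneg (j : ℕ) : 0 ≤ τ j := by positivity
  have hτ_last : τ (Fintype.card α) = t := mul_div_cancel₀ _ hN.ne'
  have hanti : Antitone fun j => Z (τ j) := fun i j hij => hZ (hτ_nonneg i) (hτ_nonneg j) (hτ hij)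
  obtain ⟨j, hj, heq⟩ := exists_eq_succ_of_antitone (N := Fintype.card α) hanti
    (by rwa [hτ_last]) le_rfl
  have hne' : (Z (τ (j + 1))).Nonempty := by
    refine hne.mono ?_
    conv_lhs => rw [← hτ_last]
    exact hanti hj
  have hle := hL _ _ (hτ_nonneg j) (hτ j.le_succ) heq hne'
  have hstep : τ (j + 1) - τ j = t / Fintype.card α := by
    simp only [τ, Nat.cast_add_one]
    ring
  rwa [hstep, div_le_iff₀' hN] at hle

end Antitone

/-! ### Divergences in a one-parameter exponential family -/

section ExpFamily

/-- The natural parameter of the member with mean `m`. -/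
def natOf (ρ : Measure ℝ) (m : ℝ) : ℝ := Function.invFunOn (meanOf ρ) (natSpace ρ) m

/-- The variance of the member with natural parameter `η`. -/
def varOf (ρ : Measure ℝ) (η : ℝ) : ℝ := Var[id; natMember ρ η]

/-- The Fisher information of the family in its mean parameter, at the member with mean `m`. -/
def fisherInfo (ρ : Measure ℝ) (m : ℝ) : ℝ := (varOf ρ (natOf ρ m))⁻¹

variable {ρ : Measure ℝ} {η η' a b l m : ℝ}

lemma isOpen_natSpace : IsOpen (natSpace ρ) := isOpen_interior

lemma convex_natSpace : Convex ℝ (natSpace ρ) := convex_integrableExpSet.interior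

lemma integrable_exp_of_mem_natSpace (hη : η ∈ natSpace ρ) :
    Integrable (fun y => Real.exp (η * y)) ρ :=
  (interior_subset hη : η ∈ integrableExpSet id ρ)

lemma meanOf_eq_deriv_cgf (hη : η ∈ natSpace ρ) : meanOf ρ η = deriv (cgf id ρ) η :=
  integral_tilted_mul_self hη

lemma varOf_eq_deriv_deriv_cgf (hη : η ∈ natSpace ρ) :
    varOf ρ η = deriv (deriv (cgf id ρ)) η := by
  rw [varOf, natMember, ← iteratedDeriv_one (f := cgf id ρ), ← iteratedDeriv_succ]
  exact variance_tilted_mul hη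

lemma hasDerivAt_cgf (hη : η ∈ natSpace ρ) : HasDerivAt (cgf id ρ) (meanOf ρ η) η := by
  rw [meanOf_eq_deriv_cgf hη]
  exact (analyticAt_cgf hη).differentiableAt.hasDerivAt

lemma hasStrictDerivAt_meanOf (hη : η ∈ natSpace ρ) :
    HasStrictDerivAt (meanOf ρ) (varOf ρ η) η := by
  rw [varOf_eq_deriv_deriv_cgf hη]
  refine (analyticAt_cgf hη).deriv.hasStrictDerivAt.congr_of_eventuallyEq ?_
  filter_upwards [isOpen_natSpace.mem_nhds hη] with y hy using (meanOf_eq_deriv_cgf hy).symm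

lemma continuousOn_meanOf : ContinuousOn (meanOf ρ) (natSpace ρ) :=
  fun _ hη => (hasStrictDerivAt_meanOf hη).hasDerivAt.continuousAt.continuousWithinAt

lemma continuousOn_varOf : ContinuousOn (varOf ρ) (natSpace ρ) := by
  refine ContinuousOn.congr ?_ fun η hη => varOf_eq_deriv_deriv_cgf hη
  exact fun η hη => (analyticAt_cgf hη).deriv.deriv.continuousAt.continuousWithinAt

lemma neZero_of_nontrivial_meanSpace (hρ : (meanSpace ρ).Nontrivial) : NeZero ρ := by
  refine ⟨fun h0 => ?_⟩
  obtain ⟨_, ⟨η₁, _, rfl⟩, _, ⟨η₂, _, rfl⟩, hne⟩ := hρ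
  simp [meanOf, natMember, h0] at hne

lemma isProbabilityMeasure_natMember [NeZero ρ] (hη : η ∈ natSpace ρ) :
    IsProbabilityMeasure (natMember ρ η) :=
  isProbabilityMeasure_tilted (integrable_exp_of_mem_natSpace hη)

lemma meanOf_eq_of_ae_eq [NeZero ρ] (hη : η ∈ natSpace ρ) (hρm : ∀ᵐ y ∂ρ, y = m) :
    meanOf ρ η = m := by
  have := isProbabilityMeasure_natMember hη
  have hae : ∀ᵐ y ∂(natMember ρ η), y = m := (tilted_absolutelyContinuous ρ _).ae_le hρm
  rw [meanOf, integral_congr_ae hae]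
  simp

lemma ae_eq_of_varOf_eq_zero [NeZero ρ] (hη : η ∈ natSpace ρ) (hvar : varOf ρ η = 0) :
    ∀ᵐ y ∂ρ, y = meanOf ρ η := by
  have := isProbabilityMeasure_natMember hη
  have hmem : MemLp id 2 (natMember ρ η) := memLp_tilted_mul (X := id) hη 2
  exact (absolutelyContinuous_tilted (integrable_exp_of_mem_natSpace hη)).ae_le
    (ae_eq_integral_of_variance_eq_zero hmem hvar)

lemma varOf_pos (hρ : (meanSpace ρ).Nontrivial) (hη : η ∈ natSpace ρ) : 0 < varOf ρ η := by
  have := neZero_of_nontrivial_meanSpace hρ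
  refine (variance_nonneg _ _).lt_of_ne' fun hvar => ?_
  have hmean : ∀ η' ∈ natSpace ρ, meanOf ρ η' = meanOf ρ η := fun η' hη' =>
    meanOf_eq_of_ae_eq hη' (ae_eq_of_varOf_eq_zero hη hvar)
  obtain ⟨_, ⟨η₁, hη₁, rfl⟩, _, ⟨η₂, hη₂, rfl⟩, hne⟩ := hρ
  exact hne ((hmean _ hη₁).trans (hmean _ hη₂).symm)

lemma strictMonoOn_meanOf (hρ : (meanSpace ρ).Nontrivial) :
    StrictMonoOn (meanOf ρ) (natSpace ρ) := by
  refine strictMonoOn_of_deriv_pos convex_natSpace continuousOn_meanOf fun η hη => ?_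
  rw [(hasStrictDerivAt_meanOf (interior_subset hη)).hasDerivAt.deriv]
  exact varOf_pos hρ (interior_subset hη)

lemma natOf_mem (hm : m ∈ meanSpace ρ) : natOf ρ m ∈ natSpace ρ := Function.invFunOn_mem hm

lemma meanOf_natOf (hm : m ∈ meanSpace ρ) : meanOf ρ (natOf ρ m) = m := Function.invFunOn_eq hm

lemma image_natOf (hρ : (meanSpace ρ).Nontrivial) : natOf ρ '' meanSpace ρ = natSpace ρ :=
  (strictMonoOn_meanOf hρ).injOn.invFunOn_image subset_rfl

lemma strictMonoOn_natOf (hρ : (meanSpace ρ).Nontrivial) :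
    StrictMonoOn (natOf ρ) (meanSpace ρ) := by
  intro m hm m' hm' hlt
  rwa [← (strictMonoOn_meanOf hρ).lt_iff_lt (natOf_mem hm) (natOf_mem hm'), meanOf_natOf hm,
    meanOf_natOf hm']

lemma isOpen_meanSpace (hρ : (meanSpace ρ).Nontrivial) : IsOpen (meanSpace ρ) := by
  rw [isOpen_iff_mem_nhds]
  rintro _ ⟨η, hη, rfl⟩
  rw [← (hasStrictDerivAt_meanOf hη).map_nhds_eq (varOf_pos hρ hη).ne']
  exact image_mem_map (isOpen_natSpace.mem_nhds hη)

lemma ordConnected_meanSpace : (meanSpace ρ).OrdConnected :=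
  (convex_natSpace.isPreconnected.image _ continuousOn_meanOf).ordConnected

lemma continuousAt_natOf (hρ : (meanSpace ρ).Nontrivial) (hm : m ∈ meanSpace ρ) :
    ContinuousAt (natOf ρ) m := by
  refine (strictMonoOn_natOf hρ).continuousAt_of_image_mem_nhds
    ((isOpen_meanSpace hρ).mem_nhds hm) ?_
  rw [image_natOf hρ]
  exact isOpen_natSpace.mem_nhds (natOf_mem hm)

lemma fisherInfo_pos (hρ : (meanSpace ρ).Nontrivial) (hm : m ∈ meanSpace ρ) :
    0 < fisherInfo ρ m :=
  inv_pos.2 (varOf_pos hρ (natOf_mem hm))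

lemma continuousOn_fisherInfo (hρ : (meanSpace ρ).Nontrivial) :
    ContinuousOn (fisherInfo ρ) (meanSpace ρ) :=
  (continuousOn_varOf.comp (fun _ hm => (continuousAt_natOf hρ hm).continuousWithinAt)
    fun _ hm => natOf_mem hm).inv₀ fun _ hm => (varOf_pos hρ (natOf_mem hm)).ne'

lemma hasDerivAt_natOf (hρ : (meanSpace ρ).Nontrivial) (hm : m ∈ meanSpace ρ) :
    HasDerivAt (natOf ρ) (fisherInfo ρ m) m := by
  refine HasDerivAt.of_local_left_inverse (continuousAt_natOf hρ hm)
    (hasStrictDerivAt_meanOf (natOf_mem hm)).hasDerivAt (varOf_pos hρ (natOf_mem hm)).ne' ?_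
  filter_upwards [(isOpen_meanSpace hρ).mem_nhds hm] with y hy using meanOf_natOf hy

lemma tilted_natMember (hη' : η' ∈ natSpace ρ) :
    (natMember ρ η').tilted (fun y => (η - η') * y) = natMember ρ η := by
  rw [natMember, natMember, tilted_tilted (integrable_exp_of_mem_natSpace hη')]
  congr 1
  ext y
  simp only [Pi.add_apply]
  ring

lemma integrable_exp_natMember (hη : η ∈ natSpace ρ) (hη' : η' ∈ natSpace ρ) :
    Integrable (fun y => Real.exp ((η - η') * y)) (natMember ρ η') := by
  rw [natMember, integrable_tilted_iff (integrable_exp_of_mem_natSpace hη')]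
  refine (integrable_exp_of_mem_natSpace hη).congr (ae_of_all _ fun y => ?_)
  simp only [smul_eq_mul, ← Real.exp_add]
  ring_nf

lemma log_integral_exp_natMember [NeZero ρ] (hη : η ∈ natSpace ρ) (hη' : η' ∈ natSpace ρ) :
    Real.log (∫ y, Real.exp ((η - η') * y) ∂(natMember ρ η')) = cgf id ρ η - cgf id ρ η' := by
  have hsum : (fun y => η' * y) + (fun y => (η - η') * y) = fun y => η * y := by
    ext y
    simp only [Pi.add_apply]
    ring
  rw [natMember, integral_exp_tilted, hsum,
    Real.log_div (integral_exp_pos (integrable_exp_of_mem_natSpace hη)).ne'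
      (integral_exp_pos (integrable_exp_of_mem_natSpace hη')).ne']
  rfl

lemma integrable_id_natMember (hη : η ∈ natSpace ρ) :
    Integrable (fun y : ℝ => y) (natMember ρ η) :=
  memLp_one_iff_integrable.1 (memLp_tilted_mul (X := id) hη 1)

lemma toReal_klDiv_natMember [NeZero ρ] (hη : η ∈ natSpace ρ) (hη' : η' ∈ natSpace ρ) :
    (InformationTheory.klDiv (natMember ρ η) (natMember ρ η')).toReal
      = (η - η') * meanOf ρ η - cgf id ρ η + cgf id ρ η' := by
  have := isProbabilityMeasure_natMember hη
  have := isProbabilityMeasure_natMember hη'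
  have hac : natMember ρ η ≪ natMember ρ η' :=
    tilted_natMember (η := η) hη' ▸ tilted_absolutelyContinuous _ _
  have hllr := log_rnDeriv_tilted_left_self (integrable_exp_natMember hη hη')
  rw [tilted_natMember hη'] at hllr
  rw [InformationTheory.toReal_klDiv_of_measure_eq hac (by simp), llr_def,
    integral_congr_ae (hac.ae_le hllr), log_integral_exp_natMember hη hη',
    integral_sub ((integrable_id_natMember hη).const_mul _) (integrable_const _),
    integral_const_mul, integral_const, probReal_univ, one_smul, meanOf]
  ring

lemma KL_eq (hρ : (meanSpace ρ).Nontrivial) (ha : a ∈ meanSpace ρ) (hl : l ∈ meanSpace ρ) :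
    KL ρ a l = (natOf ρ a - natOf ρ l) * a - cgf id ρ (natOf ρ a) + cgf id ρ (natOf ρ l) := by
  have := neZero_of_nontrivial_meanSpace hρ
  have hkl := toReal_klDiv_natMember (natOf_mem ha) (natOf_mem hl)
  rwa [meanOf_natOf ha] at hkl

lemma KL_nonneg (a l : ℝ) : 0 ≤ KL ρ a l := ENNReal.toReal_nonneg

lemma KL_self (hρ : (meanSpace ρ).Nontrivial) (ha : a ∈ meanSpace ρ) : KL ρ a a = 0 := by
  rw [KL_eq hρ ha ha]
  ring

lemma KL_compensation (hρ : (meanSpace ρ).Nontrivial) (ha : a ∈ meanSpace ρ)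
    (hb : b ∈ meanSpace ρ) (hm : m ∈ meanSpace ρ) (hl : l ∈ meanSpace ρ) {u v : ℝ}
    (hmean : (u + v) * m = u * a + v * b) :
    u * KL ρ a l + v * KL ρ b l = u * KL ρ a m + v * KL ρ b m + (u + v) * KL ρ m l := by
  simp only [KL_eq hρ ha hl, KL_eq hρ hb hl, KL_eq hρ ha hm, KL_eq hρ hb hm, KL_eq hρ hm hl]
  linear_combination (natOf ρ l - natOf ρ m) * hmean

lemma hasDerivAt_KL (hρ : (meanSpace ρ).Nontrivial) (ha : a ∈ meanSpace ρ)
    (hl : l ∈ meanSpace ρ) : HasDerivAt (KL ρ a) ((l - a) * fisherInfo ρ l) l := by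
  have hnat := hasDerivAt_natOf hρ hl
  have hcgf : HasDerivAt (fun l => cgf id ρ (natOf ρ l)) (l * fisherInfo ρ l) l := by
    have hcomp := (hasDerivAt_cgf (natOf_mem hl)).comp l hnat
    rwa [meanOf_natOf hl] at hcomp
  have hformula := (((hnat.const_sub (natOf ρ a)).mul_const a).sub_const
    (cgf id ρ (natOf ρ a))).add hcgf
  refine (hformula.congr_of_eventuallyEq ?_).congr_deriv (by ring)
  filter_upwards [(isOpen_meanSpace hρ).mem_nhds hl] with y hy using KL_eq hρ ha hy

lemma continuousOn_KL (hρ : (meanSpace ρ).Nontrivial) (ha : a ∈ meanSpace ρ) :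
    ContinuousOn (KL ρ a) (meanSpace ρ) :=
  fun _ hl => (hasDerivAt_KL hρ ha hl).continuousAt.continuousWithinAt

lemma strictMonoOn_KL (hρ : (meanSpace ρ).Nontrivial) (ha : a ∈ meanSpace ρ) :
    StrictMonoOn (KL ρ a) (meanSpace ρ ∩ Ici a) := by
  refine strictMonoOn_of_deriv_pos (ordConnected_meanSpace.inter ordConnected_Ici).convex
    ((continuousOn_KL hρ ha).mono inter_subset_left) fun l hl => ?_
  rw [interior_inter, interior_Ici] at hl
  have hlm := interior_subset hl.1
  rw [(hasDerivAt_KL hρ ha hlm).deriv]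
  exact mul_pos (sub_pos.2 hl.2) (fisherInfo_pos hρ hlm)

lemma strictAntiOn_KL (hρ : (meanSpace ρ).Nontrivial) (ha : a ∈ meanSpace ρ) :
    StrictAntiOn (KL ρ a) (meanSpace ρ ∩ Iic a) := by
  refine strictAntiOn_of_deriv_neg (ordConnected_meanSpace.inter ordConnected_Iic).convex
    ((continuousOn_KL hρ ha).mono inter_subset_left) fun l hl => ?_
  rw [interior_inter, interior_Iic] at hl
  have hlm := interior_subset hl.1
  rw [(hasDerivAt_KL hρ ha hlm).deriv]
  exact mul_neg_of_neg_of_pos (sub_neg.2 hl.2) (fisherInfo_pos hρ hlm)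

lemma KL_pos (hρ : (meanSpace ρ).Nontrivial) (ha : a ∈ meanSpace ρ) (hl : l ∈ meanSpace ρ)
    (hne : a ≠ l) : 0 < KL ρ a l := by
  rw [← KL_self hρ ha]
  rcases hne.lt_or_gt with hal | hla
  · exact strictMonoOn_KL hρ ha ⟨ha, self_mem_Ici⟩ ⟨hl, hal.le⟩ hal
  · exact strictAntiOn_KL hρ ha ⟨hl, hla.le⟩ ⟨ha, self_mem_Iic⟩ hla

end ExpFamily

/-! ### The scenario payoffs -/

section Payoff

variable {K : ℕ} {ρ : Measure ℝ} {θ : Fin K → ℝ} {b : Fin K}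
  {p p' d : Fin K → ℝ} {μ : Scenario b → ℝ} {x : Scenario b}

/-- A best-arm identification instance: at least two arms, with means in the mean space of the
family, of which `b` is the unique best one. -/
structure IsBandit (ρ : Measure ℝ) (θ : Fin K → ℝ) (b : Fin K) : Prop where
  two_le : 2 ≤ K
  mem : ∀ i, θ i ∈ meanSpace ρ
  lt : ∀ x : Scenario b, θ x < θ b

/-- The alternative mean attaining the infimum in `D p x`: the `p`-weighted average of `θ b` and
`θ x`, and `θ b` if both weights vanish. -/
def altMean (θ : Fin K → ℝ) (b : Fin K) (p : Fin K → ℝ) (x : Scenario b) : ℝ :=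
  if p b + p x = 0 then θ b else (p b * θ b + p x * θ x) / (p b + p x)

/-- The supporting linear functional of the concave function `D · x` at `p`, which is its
derivative if `p b + p x ≠ 0`. -/
def derivD (ρ : Measure ℝ) (θ : Fin K → ℝ) (b : Fin K) (p : Fin K → ℝ) (x : Scenario b) :
    (Fin K → ℝ) →L[ℝ] ℝ :=
  KL ρ (θ b) (altMean θ b p x) • ContinuousLinearMap.proj b
    + KL ρ (θ x) (altMean θ b p x) • ContinuousLinearMap.proj x.1

/-- The gradient of the payoff in the first variable, at its points of differentiability. -/
def gradPayoff (ρ : Measure ℝ) (θ : Fin K → ℝ) (b : Fin K) (p : Fin K → ℝ)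
    (μ : Scenario b → ℝ) : Fin K → ℝ :=
  fun i => ∑ x, μ x * derivD ρ θ b p x (Pi.single i 1)

/-- The one-sided derivative of `D · x` at `p` in the direction `d`. -/
def dirDerivD (ρ : Measure ℝ) (θ : Fin K → ℝ) (b : Fin K) (p : Fin K → ℝ) (x : Scenario b)
    (d : Fin K → ℝ) : ℝ :=
  if p b + p x = 0 then D ρ θ b d x else derivD ρ θ b p x d

lemma derivD_apply (p d : Fin K → ℝ) (x : Scenario b) :
    derivD ρ θ b p x d
      = d b * KL ρ (θ b) (altMean θ b p x) + d x * KL ρ (θ x) (altMean θ b p x) := by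
  simp only [derivD, add_apply, smul_apply, ContinuousLinearMap.proj_apply, smul_eq_mul, mul_comm]

lemma derivD_single_best (p : Fin K → ℝ) (x : Scenario b) :
    derivD ρ θ b p x (Pi.single b 1) = KL ρ (θ b) (altMean θ b p x) := by
  rw [derivD_apply, Pi.single_eq_same, Pi.single_eq_of_ne x.2, one_mul, zero_mul, add_zero]

lemma derivD_single_self (p : Fin K → ℝ) (x : Scenario b) :
    derivD ρ θ b p x (Pi.single x.1 1) = KL ρ (θ x) (altMean θ b p x) := by
  rw [derivD_apply, Pi.single_eq_same, Pi.single_eq_of_ne x.2.symm, one_mul, zero_mul, zero_add]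

lemma derivD_nonneg (hd : d ∈ orthant (Fin K)) : 0 ≤ derivD ρ θ b p x d := by
  rw [derivD_apply]
  exact add_nonneg (mul_nonneg (hd b) (KL_nonneg _ _)) (mul_nonneg (hd x) (KL_nonneg _ _))

lemma derivD_eq_dotProduct (q p : Fin K → ℝ) (x : Scenario b) :
    derivD ρ θ b p x q = q ⬝ᵥ fun i => derivD ρ θ b p x (Pi.single i 1) := by
  conv_lhs => rw [pi_eq_sum_univ' q]
  simp only [map_sum, map_smul, smul_eq_mul, dotProduct]

lemma dotProduct_gradPayoff (q p : Fin K → ℝ) (μ : Scenario b → ℝ) :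
    q ⬝ᵥ gradPayoff ρ θ b p μ = ∑ x, μ x * derivD ρ θ b p x q := by
  simp only [derivD_eq_dotProduct q, dotProduct, gradPayoff, Finset.mul_sum]
  rw [Finset.sum_comm]
  simp only [mul_left_comm]

lemma gradPayoff_scenario (p : Fin K → ℝ) (μ : Scenario b → ℝ) (x : Scenario b) :
    gradPayoff ρ θ b p μ x = μ x * KL ρ (θ x) (altMean θ b p x) := by
  rw [gradPayoff, Finset.sum_eq_single x, derivD_single_self]
  · intro y _ hyx
    rw [derivD_apply, Pi.single_eq_of_ne x.2.symm,
      Pi.single_eq_of_ne fun hyx' => hyx (Subtype.ext hyx')]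
    ring
  · exact fun hx => absurd (Finset.mem_univ x) hx

lemma altMean_of_eq_zero_left (hb : p b = 0) (hx : p x ≠ 0) : altMean θ b p x = θ x := by
  rw [altMean, hb, zero_add, if_neg hx, zero_mul, zero_add, mul_div_cancel_left₀ _ hx]

lemma altMean_of_eq_zero_right (hx : p x = 0) : altMean θ b p x = θ b := by
  rw [altMean, hx, add_zero, zero_mul, add_zero]
  split_ifs with hb
  · rfl
  · exact mul_div_cancel_left₀ _ hb

lemma continuousAt_altMean (hp : p b + p x ≠ 0) : ContinuousAt (fun p => altMean θ b p x) p := by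
  have hquot : ContinuousAt (fun p : Fin K → ℝ => (p b * θ b + p x * θ x) / (p b + p x)) p :=
    ContinuousAt.div (by fun_prop) (by fun_prop) hp
  have hne : ∀ᶠ p' : Fin K → ℝ in 𝓝 p, p' b + p' x ≠ 0 :=
    ContinuousAt.eventually_ne (by fun_prop) hp
  refine hquot.congr ?_
  filter_upwards [hne] with p' hp' using (if_neg hp').symm

lemma add_pos_of_mem_orthant (hp : p ∈ orthant (Fin K)) (hne : p b + p x ≠ 0) :
    0 < p b + p x :=
  (add_nonneg (hp b) (hp x)).lt_of_ne' hne

lemma eq_zero_of_add_eq_zero (hp : p ∈ orthant (Fin K)) (hzero : p b + p x = 0) :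
    p b = 0 ∧ p x = 0 :=
  (add_eq_zero_iff_of_nonneg (hp b) (hp x)).1 hzero

lemma add_mul_altMean (hp : p ∈ orthant (Fin K)) (x : Scenario b) :
    (p b + p x) * altMean θ b p x = p b * θ b + p x * θ x := by
  rw [altMean]
  split_ifs with hne
  · obtain ⟨hb, hx⟩ := eq_zero_of_add_eq_zero hp hne
    simp only [hb, hx, add_zero, zero_mul]
  · exact mul_div_cancel₀ _ hne

lemma D_smul {t : ℝ} (ht : 0 ≤ t) (p : Fin K → ℝ) (x : Scenario b) :
    D ρ θ b (t • p) x = t * D ρ θ b p x := by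
  rw [D, D, ← smul_eq_mul, ← Real.sInf_smul_of_nonneg ht, ← image_smul, image_image]
  simp only [Pi.smul_apply, smul_eq_mul, mul_add, mul_assoc]

lemma gradMu_payoff (z : (Fin K → ℝ) × (Scenario b → ℝ)) :
    gradMu (payoff ρ θ b) z = D ρ θ b z.1 := by
  ext x
  have hderiv : HasFDerivAt (fun μ : Scenario b → ℝ => payoff ρ θ b (z.1, μ))
      (∑ x : Scenario b, D ρ θ b z.1 x • (ContinuousLinearMap.proj x :
        (Scenario b → ℝ) →L[ℝ] ℝ)) z.2 :=
    HasFDerivAt.fun_sum fun x _ =>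
      (hasFDerivAt_apply (𝕜 := ℝ) (F' := fun _ : Scenario b => ℝ) x z.2).mul_const
        (D ρ θ b z.1 x)
  rw [gradMu, hderiv.fderiv]
  simp [Pi.single_apply]

lemma kappaMin_le_max_KL {l : ℝ} (hl : l ∈ Icc (θ x) (θ b)) :
    kappaMin ρ θ b ≤ max (KL ρ (θ x) l) (KL ρ (θ b) l) := by
  refine (ciInf_le (finite_range _).bddBelow x).trans (csInf_le ⟨0, ?_⟩ ⟨l, hl, rfl⟩)
  rintro _ ⟨l', -, rfl⟩
  exact le_max_of_le_left (KL_nonneg _ _)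

namespace IsBandit

lemma nonempty (h : IsBandit ρ θ b) : Nonempty (Scenario b) := by
  have : Nontrivial (Fin K) := Fin.nontrivial_iff_two_le.2 h.two_le
  obtain ⟨x, hx⟩ := exists_ne b
  exact ⟨⟨x, hx⟩⟩

lemma nontrivial_meanSpace (h : IsBandit ρ θ b) : (meanSpace ρ).Nontrivial := by
  obtain ⟨x⟩ := h.nonempty
  exact ⟨θ x, h.mem x, θ b, h.mem b, (h.lt x).ne⟩

lemma Icc_subset_meanSpace (h : IsBandit ρ θ b) (x : Scenario b) :
    Icc (θ x) (θ b) ⊆ meanSpace ρ :=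
  ordConnected_meanSpace.out (h.mem x) (h.mem b)

lemma altMean_mem_Icc (h : IsBandit ρ θ b) (hp : p ∈ orthant (Fin K)) (x : Scenario b) :
    altMean θ b p x ∈ Icc (θ x) (θ b) := by
  have hlt := h.lt x
  have hb := hp b
  have hx := hp x
  rw [altMean]
  split_ifs with hne
  · exact right_mem_Icc.2 hlt.le
  · have hpos := add_pos_of_mem_orthant hp hne
    rw [mem_Icc, le_div_iff₀ hpos, div_le_iff₀ hpos]
    constructor <;> nlinarith

lemma altMean_mem_meanSpace (h : IsBandit ρ θ b) (hp : p ∈ orthant (Fin K)) (x : Scenario b) :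
    altMean θ b p x ∈ meanSpace ρ :=
  h.Icc_subset_meanSpace x (h.altMean_mem_Icc hp x)

lemma D_le_derivD (h : IsBandit ρ θ b) (hp : p ∈ orthant (Fin K)) (hp' : p' ∈ orthant (Fin K))
    (x : Scenario b) : D ρ θ b p' x ≤ derivD ρ θ b p x p' := by
  rw [derivD_apply]
  refine csInf_le ⟨0, ?_⟩ ⟨_, h.altMean_mem_Icc hp x, rfl⟩
  rintro _ ⟨l, -, rfl⟩
  exact add_nonneg (mul_nonneg (hp' b) (KL_nonneg _ _)) (mul_nonneg (hp' x) (KL_nonneg _ _))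

lemma D_eq_derivD (h : IsBandit ρ θ b) (hp : p ∈ orthant (Fin K)) (x : Scenario b) :
    D ρ θ b p x = derivD ρ θ b p x p := by
  refine le_antisymm (h.D_le_derivD hp hp x)
    (le_csInf ((nonempty_Icc.2 (h.lt x).le).image _) ?_)
  rintro _ ⟨l, hl, rfl⟩
  have hcomp := KL_compensation h.nontrivial_meanSpace (h.mem b) (h.mem x)
    (h.altMean_mem_meanSpace hp x) (h.Icc_subset_meanSpace x hl) (add_mul_altMean hp x)
  have hrest := mul_nonneg (add_nonneg (hp b) (hp x)) (KL_nonneg (ρ := ρ) (altMean θ b p x) l)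
  rw [derivD_apply]
  linarith

lemma payoff_eq_dotProduct (h : IsBandit ρ θ b) (hp : p ∈ orthant (Fin K))
    (μ : Scenario b → ℝ) : payoff ρ θ b (p, μ) = p ⬝ᵥ gradPayoff ρ θ b p μ := by
  rw [dotProduct_gradPayoff]
  exact Finset.sum_congr rfl fun x _ => by rw [h.D_eq_derivD hp x]

lemma D_nonneg (h : IsBandit ρ θ b) (hp : p ∈ orthant (Fin K)) (x : Scenario b) :
    0 ≤ D ρ θ b p x :=
  (h.D_eq_derivD hp x).symm ▸ derivD_nonneg hp

lemma max_KL_pos (h : IsBandit ρ θ b) {l : ℝ} (hl : l ∈ Icc (θ x) (θ b)) :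
    0 < max (KL ρ (θ x) l) (KL ρ (θ b) l) := by
  have hmem := h.Icc_subset_meanSpace x hl
  rcases eq_or_ne (θ x) l with rfl | hne
  · exact lt_max_of_lt_right (KL_pos h.nontrivial_meanSpace (h.mem b) hmem (h.lt x).ne')
  · exact lt_max_of_lt_left (KL_pos h.nontrivial_meanSpace (h.mem x) hmem hne)

lemma D_pos (h : IsBandit ρ θ b) (hp : p ∈ orthant (Fin K)) (hb : 0 < p b) (hx : 0 < p x) :
    0 < D ρ θ b p x := by
  rw [h.D_eq_derivD hp, derivD_apply]
  have hKLb := KL_nonneg (ρ := ρ) (θ b) (altMean θ b p x)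
  have hKLx := KL_nonneg (ρ := ρ) (θ x) (altMean θ b p x)
  rcases lt_max_iff.1 (h.max_KL_pos (h.altMean_mem_Icc hp x)) with hpos | hpos <;> positivity

lemma D_of_eq_zero_right (h : IsBandit ρ θ b) (hp : p ∈ orthant (Fin K)) (hx : p x = 0) :
    D ρ θ b p x = 0 := by
  rw [h.D_eq_derivD hp, derivD_apply, altMean_of_eq_zero_right hx,
    KL_self h.nontrivial_meanSpace (h.mem b), hx, mul_zero, zero_mul, add_zero]

lemma D_of_eq_zero_left (h : IsBandit ρ θ b) (hp : p ∈ orthant (Fin K)) (hb : p b = 0) :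
    D ρ θ b p x = 0 := by
  by_cases hx : p x = 0
  · exact h.D_of_eq_zero_right hp hx
  · rw [h.D_eq_derivD hp, derivD_apply, altMean_of_eq_zero_left hb hx,
      KL_self h.nontrivial_meanSpace (h.mem x), hb, mul_zero, zero_mul, add_zero]

lemma D_single (h : IsBandit ρ θ b) (i : Fin K) (x : Scenario b) :
    D ρ θ b (Pi.single i 1) x = 0 := by
  by_cases hi : b = i
  · subst hi
    exact h.D_of_eq_zero_right (single_mem_orthant _) (Pi.single_eq_of_ne x.2 _)
  · exact h.D_of_eq_zero_left (single_mem_orthant i) (Pi.single_eq_of_ne hi _)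

lemma continuousAt_KL_altMean (h : IsBandit ρ θ b) (hp : p ∈ orthant (Fin K))
    (hne : p b + p x ≠ 0) (i : Fin K) :
    ContinuousAt (fun p => KL ρ (θ i) (altMean θ b p x)) p :=
  ContinuousAt.comp (f := fun p => altMean θ b p x) (g := KL ρ (θ i))
    (hasDerivAt_KL h.nontrivial_meanSpace (h.mem i) (h.altMean_mem_meanSpace hp x)).continuousAt
    (continuousAt_altMean hne)

lemma hasFDerivWithinAt_D (h : IsBandit ρ θ b) (hp : p ∈ orthant (Fin K))
    (hne : p b + p x ≠ 0) :
    HasFDerivWithinAt (fun p => D ρ θ b p x) (derivD ρ θ b p x) (orthant (Fin K)) p := by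
  refine hasFDerivWithinAt_of_supergradient (L := fun p => derivD ρ θ b p x) ?_ hp ?_
  · intro y hy w hw
    rw [map_sub, h.D_eq_derivD hy x, add_sub_cancel]
    exact h.D_le_derivD hy hw x
  · exact (((h.continuousAt_KL_altMean hp hne b).smul continuousAt_const).add
      ((h.continuousAt_KL_altMean hp hne x).smul continuousAt_const)).continuousWithinAt

lemma differentiableWithinAt_payoff (h : IsBandit ρ θ b)
    {z : (Fin K → ℝ) × (Scenario b → ℝ)} (hz : z.1 ∈ orthant (Fin K))
    (hne : ∀ x : Scenario b, z.1 b + z.1 x ≠ 0) :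
    DifferentiableWithinAt ℝ (payoff ρ θ b) (orthant (Fin K) ×ˢ univ) z := by
  refine DifferentiableWithinAt.fun_sum fun x _ => ?_
  have hD : HasFDerivWithinAt (fun z : (Fin K → ℝ) × (Scenario b → ℝ) => D ρ θ b z.1 x)
      ((derivD ρ θ b z.1 x).comp (ContinuousLinearMap.fst ℝ _ _)) (orthant (Fin K) ×ˢ univ) z :=
    (h.hasFDerivWithinAt_D hz (hne x)).comp z hasFDerivWithinAt_fst fun _ hy => hy.1
  have hweight : DifferentiableWithinAt ℝ (fun z : (Fin K → ℝ) × (Scenario b → ℝ) => z.2 x)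
      (orthant (Fin K) ×ˢ univ) z :=
    differentiableWithinAt_pi.1 differentiableWithinAt_snd x
  exact hweight.mul hD.differentiableWithinAt

lemma differentiableAt_payoff (h : IsBandit ρ θ b) (hp : ∀ i, 0 < p i) :
    DifferentiableAt ℝ (payoff ρ θ b) (p, μ) :=
  (h.differentiableWithinAt_payoff (z := (p, μ)) (fun i => (hp i).le)
    fun x => (add_pos (hp b) (hp x)).ne').differentiableAt
    (prod_mem_nhds (orthant_mem_nhds hp) univ_mem)

lemma hasDerivWithinAt_D_ray (h : IsBandit ρ θ b) (hp : p ∈ orthant (Fin K))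
    (hd : d ∈ orthant (Fin K)) (x : Scenario b) :
    HasDerivWithinAt (fun t : ℝ => D ρ θ b (p + t • d) x) (dirDerivD ρ θ b p x d) (Ici 0) 0 := by
  rw [dirDerivD]
  split_ifs with hzero
  · obtain ⟨hb, hx⟩ := eq_zero_of_add_eq_zero hp hzero
    have hlin : ∀ t ∈ Ici (0 : ℝ), D ρ θ b (p + t • d) x = t * D ρ θ b d x := by
      intro t ht
      rw [← D_smul ht]
      simp only [D, Pi.add_apply, Pi.smul_apply, hb, hx, zero_add]
    exact (by simpa using ((hasDerivAt_id (0 : ℝ)).mul_const (D ρ θ b d x)).hasDerivWithinAt :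
      HasDerivWithinAt (fun t : ℝ => t * D ρ θ b d x) _ _ _).congr hlin (hlin 0 self_mem_Ici)
  · have hline : HasDerivWithinAt (fun t : ℝ => p + t • d) d (Ici 0) 0 := by
      simpa using (((hasDerivAt_id (0 : ℝ)).smul_const d).const_add p).hasDerivWithinAt
    have hD : HasFDerivWithinAt (fun p => D ρ θ b p x) (derivD ρ θ b p x) (orthant (Fin K))
        (p + (0 : ℝ) • d) := by
      simpa using h.hasFDerivWithinAt_D hp hzero
    exact hD.comp_hasDerivWithinAt (0 : ℝ) hline fun t ht => add_smul_mem_orthant hp hd ht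

lemma fderivWithin_D_apply (h : IsBandit ρ θ b) (hp : p ∈ orthant (Fin K))
    (hdiff : DifferentiableWithinAt ℝ (fun p => D ρ θ b p x) (orthant (Fin K)) p)
    (hd : d ∈ orthant (Fin K)) :
    fderivWithin ℝ (fun p => D ρ θ b p x) (orthant (Fin K)) p d = dirDerivD ρ θ b p x d :=
  fderivWithin_apply_eq_of_ray hdiff (fun _ ht => add_smul_mem_orthant hp hd ht)
    (h.hasDerivWithinAt_D_ray hp hd x)

lemma fderivWithin_payoff_apply (h : IsBandit ρ θ b) (hp : p ∈ orthant (Fin K))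
    (hdiff : DifferentiableWithinAt ℝ (payoff ρ θ b) (orthant (Fin K) ×ˢ univ) (p, μ))
    (hd : d ∈ orthant (Fin K)) :
    fderivWithin ℝ (payoff ρ θ b) (orthant (Fin K) ×ˢ univ) (p, μ) (d, 0)
      = ∑ x, μ x * dirDerivD ρ θ b p x d := by
  refine fderivWithin_apply_eq_of_ray hdiff
    (fun t ht => ⟨add_smul_mem_orthant hp hd ht, mem_univ _⟩) ?_
  simp only [payoff, Prod.smul_mk, Prod.mk_add_mk, smul_zero, add_zero]
  exact HasDerivWithinAt.fun_sum fun x _ => (h.hasDerivWithinAt_D_ray hp hd x).const_mul _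

/-! ### The gradient bound -/

lemma KL_altMean_best_le (h : IsBandit ρ θ b) (hp : p ∈ orthant (Fin K)) (x : Scenario b) :
    KL ρ (θ b) (altMean θ b p x) ≤ KL ρ (θ b) (θ x) := by
  have hmem := h.altMean_mem_Icc hp x
  exact (strictAntiOn_KL h.nontrivial_meanSpace (h.mem b)).antitoneOn ⟨h.mem x, (h.lt x).le⟩
    ⟨h.altMean_mem_meanSpace hp x, hmem.2⟩ hmem.1

lemma KL_altMean_scenario_le (h : IsBandit ρ θ b) (hp : p ∈ orthant (Fin K)) (x : Scenario b) :
    KL ρ (θ x) (altMean θ b p x) ≤ KL ρ (θ x) (θ b) := by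
  have hmem := h.altMean_mem_Icc hp x
  exact (strictMonoOn_KL h.nontrivial_meanSpace (h.mem x)).monotoneOn
    ⟨h.altMean_mem_meanSpace hp x, hmem.1⟩ ⟨h.mem b, (h.lt x).le⟩ hmem.2

lemma derivD_single_le (h : IsBandit ρ θ b) (hp : p ∈ orthant (Fin K)) (x : Scenario b)
    (i : Fin K) :
    derivD ρ θ b p x (Pi.single i 1) ≤ KL ρ (θ b) (θ x) + KL ρ (θ x) (θ b) := by
  have hle_one (j : Fin K) : (Pi.single i 1 : Fin K → ℝ) j ≤ 1 :=
    (mem_Icc_of_mem_stdSimplex (single_mem_stdSimplex ℝ i) j).2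
  rw [derivD_apply]
  exact add_le_add
    ((mul_le_of_le_one_left (KL_nonneg _ _) (hle_one _)).trans (h.KL_altMean_best_le hp x))
    ((mul_le_of_le_one_left (KL_nonneg _ _) (hle_one _)).trans (h.KL_altMean_scenario_le hp x))

lemma exists_isGradBound (h : IsBandit ρ θ b) : ∃ M : ℝ, IsGradBound ρ θ b M := by
  have hnonneg (x : Scenario b) : 0 ≤ KL ρ (θ b) (θ x) + KL ρ (θ x) (θ b) :=
    add_nonneg (KL_nonneg _ _) (KL_nonneg _ _)
  refine ⟨∑ x : Scenario b, (KL ρ (θ b) (θ x) + KL ρ (θ x) (θ b)), fun x p hp hdiff i => ?_⟩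
  refine le_trans ?_ (Finset.single_le_sum (fun x _ => hnonneg x) (Finset.mem_univ x))
  rw [h.fderivWithin_D_apply hp.1 hdiff (single_mem_orthant i), dirDerivD]
  split_ifs
  · rw [h.D_single, abs_zero]
    exact hnonneg x
  · rw [abs_of_nonneg (derivD_nonneg (single_mem_orthant i))]
    exact h.derivD_single_le hp.1 x i

lemma derivD_single_le_of_isGradBound (h : IsBandit ρ θ b) {M : ℝ} (hM : IsGradBound ρ θ b M)
    (hp : p ∈ stdSimplex ℝ (Fin K)) (hne : p b + p x ≠ 0) (i : Fin K) :
    derivD ρ θ b p x (Pi.single i 1) ≤ M := by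
  have hderiv := h.hasFDerivWithinAt_D hp.1 hne
  have hle := hM x p hp hderiv.differentiableWithinAt i
  rw [hderiv.fderivWithin (uniqueDiffOn_orthant p hp.1)] at hle
  exact (le_abs_self _).trans hle

lemma derivD_le_of_isGradBound (h : IsBandit ρ θ b) {M : ℝ} (hM : IsGradBound ρ θ b M)
    (hp : p ∈ stdSimplex ℝ (Fin K)) (hne : p b + p x ≠ 0) (hd : d ∈ stdSimplex ℝ (Fin K)) :
    derivD ρ θ b p x d ≤ M := by
  rw [derivD_eq_dotProduct]
  exact dotProduct_le_of_forall_le hd (h.derivD_single_le_of_isGradBound hM hp hne)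

lemma isGradBound_pos (h : IsBandit ρ θ b) {M : ℝ} (hM : IsGradBound ρ θ b M) : 0 < M := by
  obtain ⟨x⟩ := h.nonempty
  have hb : (Pi.single x.1 1 : Fin K → ℝ) b = 0 := Pi.single_eq_of_ne x.2.symm _
  have hx : (Pi.single x.1 1 : Fin K → ℝ) x = 1 := Pi.single_eq_same _ _
  have hle := h.derivD_single_le_of_isGradBound hM (single_mem_stdSimplex ℝ x.1) (x := x)
    (by rw [hb, hx]; norm_num) b
  rw [derivD_single_best, altMean_of_eq_zero_left hb (by rw [hx]; exact one_ne_zero)] at hle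
  exact (KL_pos h.nontrivial_meanSpace (h.mem b) (h.mem x) (h.lt x).ne').trans_le hle

/-! ### The generalized gradient of the payoff -/

-- A derivative is additive in the direction, so the defects of additivity along `eb` and `ex`
-- cancel in the mixture; they are nonnegative, and positive in a scenario without any weight.
lemma eq_zero_of_mem_diffSet (h : IsBandit ρ θ b) (hz : (p, μ) ∈ diffSet (payoff ρ θ b))
    (hx : p b + p x = 0) : μ x = 0 := by
  obtain ⟨⟨hp, -⟩, ⟨hμ, -⟩, hdiff⟩ := hz
  set eb : Fin K → ℝ := Pi.single b 1
  set ex : Fin K → ℝ := Pi.single x.1 1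
  have heb : eb ∈ orthant (Fin K) := single_mem_orthant b
  have hex : ex ∈ orthant (Fin K) := single_mem_orthant x.1
  have hebx : eb + ex ∈ orthant (Fin K) := fun i => add_nonneg (heb i) (hex i)
  set δ : Scenario b → ℝ := fun y =>
    dirDerivD ρ θ b p y (eb + ex) - dirDerivD ρ θ b p y eb - dirDerivD ρ θ b p y ex with hδ
  have hδ_of_eq (y : Scenario b) (hy : p b + p y = 0) : δ y = D ρ θ b (eb + ex) y := by
    simp only [hδ, dirDerivD, if_pos hy, eb, ex, h.D_single, sub_zero]
  have hδ_nonneg (y : Scenario b) : 0 ≤ δ y := by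
    by_cases hy : p b + p y = 0
    · exact hδ_of_eq y hy ▸ h.D_nonneg hebx y
    · simp only [hδ, dirDerivD, if_neg hy, map_add]
      linarith
  have hsum : ∑ y, μ y * δ y = 0 := by
    have hadd : ((eb + ex, 0) : (Fin K → ℝ) × (Scenario b → ℝ)) = (eb, 0) + (ex, 0) := by simp
    have hlin := congrArg (fderivWithin ℝ (payoff ρ θ b) (orthant (Fin K) ×ˢ univ) (p, μ)) hadd
    rw [map_add, h.fderivWithin_payoff_apply hp hdiff hebx,
      h.fderivWithin_payoff_apply hp hdiff heb, h.fderivWithin_payoff_apply hp hdiff hex] at hlin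
    simp only [hδ, mul_sub, Finset.sum_sub_distrib, hlin]
    ring
  have hterm := (Finset.sum_eq_zero_iff_of_nonneg fun y _ =>
    mul_nonneg (hμ y) (hδ_nonneg y)).1 hsum x (Finset.mem_univ x)
  rw [hδ_of_eq x hx] at hterm
  refine (mul_eq_zero.1 hterm).resolve_right (h.D_pos hebx ?_ ?_).ne' <;>
    simp [eb, ex, x.2, x.2.symm]

lemma gradP_eq_gradPayoff (h : IsBandit ρ θ b) {z : (Fin K → ℝ) × (Scenario b → ℝ)}
    (hz : z ∈ diffSet (payoff ρ θ b)) :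
    gradP (payoff ρ θ b) z = gradPayoff ρ θ b z.1 z.2 := by
  ext i
  rw [gradP, h.fderivWithin_payoff_apply hz.1.1 hz.2.2 (single_mem_orthant i), gradPayoff]
  refine Finset.sum_congr rfl fun x _ => ?_
  by_cases hx : z.1 b + z.1 x = 0
  · simp only [h.eq_zero_of_mem_diffSet hz hx, zero_mul]
  · rw [dirDerivD, if_neg hx]

lemma continuousAt_gradPayoff (h : IsBandit ρ θ b) (hp : p ∈ orthant (Fin K)) (hb : 0 < p b) :
    ContinuousAt (fun z : (Fin K → ℝ) × (Scenario b → ℝ) => gradPayoff ρ θ b z.1 z.2) (p, μ) := by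
  refine continuousAt_pi.2 fun i => tendsto_finsetSum _ fun x _ => ?_
  have hKL (j : Fin K) : ContinuousAt
      (fun z : (Fin K → ℝ) × (Scenario b → ℝ) => KL ρ (θ j) (altMean θ b z.1 x)) (p, μ) :=
    ContinuousAt.comp (f := Prod.fst) (g := fun p => KL ρ (θ j) (altMean θ b p x))
      (h.continuousAt_KL_altMean hp (add_pos_of_pos_of_nonneg hb (hp x)).ne' j) continuousAt_fst
  simp only [derivD_apply]
  exact ContinuousAt.mul (by fun_prop) (((hKL b).const_mul _).add ((hKL x).const_mul _))

lemma clarkeP_subset_singleton (h : IsBandit ρ θ b) (hp : p ∈ orthant (Fin K)) (hb : 0 < p b) :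
    clarkeP (payoff ρ θ b) (p, μ) ⊆ {gradPayoff ρ θ b p μ} :=
  fun _ hf => funext fun i => apply_eq_of_mem_clarkeP (fun _ hz => h.gradP_eq_gradPayoff hz)
    (continuousAt_pi.1 (h.continuousAt_gradPayoff hp hb) i) hf

lemma apply_eq_zero_of_mem_clarkeP (h : IsBandit ρ θ b) (hp : p ∈ orthant (Fin K))
    (hb : p b = 0) (hx : p x ≠ 0) {f : Fin K → ℝ} (hf : f ∈ clarkeP (payoff ρ θ b) (p, μ)) :
    f x = 0 := by
  have hKL : ContinuousAt
      (fun z : (Fin K → ℝ) × (Scenario b → ℝ) => KL ρ (θ x) (altMean θ b z.1 x)) (p, μ) :=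
    ContinuousAt.comp (f := Prod.fst) (g := fun p => KL ρ (θ x) (altMean θ b p x))
      (h.continuousAt_KL_altMean hp (by rwa [hb, zero_add]) x) continuousAt_fst
  rw [apply_eq_of_mem_clarkeP (fun _ hz => h.gradP_eq_gradPayoff hz) (i := x) ?_ hf,
    gradPayoff_scenario, altMean_of_eq_zero_left hb hx,
    KL_self h.nontrivial_meanSpace (h.mem x), mul_zero]
  simp only [gradPayoff_scenario]
  exact ContinuousAt.mul (by fun_prop) hKL

lemma kappa_pos (h : IsBandit ρ θ b) (x : Scenario b) : 0 < kappa ρ θ b x := by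
  have hcont : ContinuousOn (fun l => max (KL ρ (θ x) l) (KL ρ (θ b) l)) (Icc (θ x) (θ b)) :=
    ((continuousOn_KL h.nontrivial_meanSpace (h.mem x)).sup
      (continuousOn_KL h.nontrivial_meanSpace (h.mem b))).mono (h.Icc_subset_meanSpace x)
  obtain ⟨l, hl, hleq⟩ := (isCompact_Icc.image_of_continuousOn hcont).sInf_mem
    ((nonempty_Icc.2 (h.lt x).le).image _)
  rw [kappa, ← hleq]
  exact h.max_KL_pos hl

lemma kappaMin_pos (h : IsBandit ρ θ b) : 0 < kappaMin ρ θ b := by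
  have := h.nonempty
  obtain ⟨x, hx⟩ := exists_eq_ciInf_of_finite (f := fun x : Scenario b => kappa ρ θ b x)
  rw [kappaMin, ← hx]
  exact h.kappa_pos x

lemma kappaMin_le_sum_gradPayoff (h : IsBandit ρ θ b) (hp : p ∈ orthant (Fin K))
    (hμ : μ ∈ stdSimplex ℝ (Scenario b)) : kappaMin ρ θ b ≤ ∑ i, gradPayoff ρ θ b p μ i := by
  rw [← one_dotProduct, dotProduct_gradPayoff]
  refine le_dotProduct_of_forall_le hμ fun x => ?_
  rw [derivD_apply, Pi.one_apply, Pi.one_apply, one_mul, one_mul, add_comm]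
  exact (kappaMin_le_max_KL (h.altMean_mem_Icc hp x)).trans
    (max_le_add_of_nonneg (KL_nonneg _ _) (KL_nonneg _ _))

lemma kappaMin_le_sum_of_mem_clarkeP (h : IsBandit ρ θ b)
    {z : (Fin K → ℝ) × (Scenario b → ℝ)} {f : Fin K → ℝ}
    (hf : f ∈ clarkeP (payoff ρ θ b) z) : kappaMin ρ θ b ≤ ∑ i, f i := by
  have hconv : Convex ℝ {f : Fin K → ℝ | kappaMin ρ θ b ≤ ∑ i, f i} :=
    convex_halfSpace_ge (f := fun f : Fin K → ℝ => ∑ i, f i)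
      ⟨fun f g => Finset.sum_add_distrib, fun c f => (Finset.mul_sum _ _ _).symm⟩ _
  refine clarkeP_subset hconv (isClosed_le continuous_const (by fun_prop)) (fun z' hz' => ?_) hf
  rw [mem_ofPred_eq, h.gradP_eq_gradPayoff hz']
  exact h.kappaMin_le_sum_gradPayoff hz'.1.1 hz'.2.1

end IsBandit

end Payoff

/-! ### Entry into the interior -/

section Entry

variable {K : ℕ} {ρ : Measure ℝ} {θ : Fin K → ℝ} {b : Fin K}

/-- The scenarios whose arm has no weight under `p`. -/
def unplayed (b : Fin K) (p : Fin K → ℝ) : Finset (Scenario b) :=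
  Finset.univ.filter fun x => p x = 0

lemma mem_unplayed {p : Fin K → ℝ} {x : Scenario b} : x ∈ unplayed b p ↔ p x = 0 := by
  simp only [unplayed, Finset.mem_filter, Finset.mem_univ, true_and]

lemma antitoneOn_unplayed {p : ℝ → Fin K → ℝ} (hp : IsRelaxation p) :
    AntitoneOn (fun r => unplayed b (p r)) (Ici 0) := fun s hs t _ hst x hx => by
  rw [mem_unplayed] at hx ⊢
  exact hp.eq_zero_of_eq_zero hs hst hx

lemma card_scenario (b : Fin K) : (Fintype.card (Scenario b) : ℝ) = K - 1 := by
  have hcard : Fintype.card (Scenario b) = K - 1 := by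
    rw [Fintype.card_subtype_compl, Fintype.card_fin, Fintype.card_unique]
  rw [hcard, Nat.cast_pred b.pos]

namespace IsBandit

section

variable {M : ℝ} {p q : Fin K → ℝ} {μ ν : Scenario b → ℝ} {x y : Scenario b}
  {Z : Finset (Scenario b)}

lemma eps0_pos (h : IsBandit ρ θ b) (hM : IsGradBound ρ θ b M) : 0 < eps0 ρ θ b M := by
  have hMpos := h.isGradBound_pos hM
  have hκ := h.kappaMin_pos
  have hK : (0 : ℝ) < K := Nat.cast_pos.2 b.pos
  exact lt_min (by norm_num) (by positivity)

lemma log_one_div_eps0_nonneg (h : IsBandit ρ θ b) (hM : IsGradBound ρ θ b M) :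
    0 ≤ Real.log (1 / eps0 ρ θ b M) := by
  refine Real.log_nonneg ?_
  rw [le_div_iff₀ (h.eps0_pos hM), one_mul]
  exact (min_le_left _ _).trans (by norm_num)

lemma mul_eps0_le (h : IsBandit ρ θ b) (hM : IsGradBound ρ θ b M) :
    K * (M * eps0 ρ θ b M) ≤ kappaMin ρ θ b / 4 := by
  have hMpos := h.isGradBound_pos hM
  have hK : (0 : ℝ) < K := Nat.cast_pos.2 b.pos
  calc K * (M * eps0 ρ θ b M) ≤ K * (M * (kappaMin ρ θ b / (4 * K * M))) := by
        gcongr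
        exact min_le_right _ _
    _ = kappaMin ρ θ b / 4 := by field_simp

lemma card_mul_log_lt_Tstar (h : IsBandit ρ θ b) (M : ℝ) :
    Fintype.card (Scenario b) * Real.log (1 / eps0 ρ θ b M) < Tstar ρ θ b M := by
  have := h.nonempty
  have hcard : (0 : ℝ) < Fintype.card (Scenario b) := Nat.cast_pos.2 Fintype.card_pos
  rw [Tstar, ← card_scenario b]
  exact mul_lt_mul_of_pos_left (lt_add_of_pos_right _ (Real.log_pos one_lt_two)) hcard

lemma dotProduct_gradPayoff_le (h : IsBandit ρ θ b) (hM : IsGradBound ρ θ b M)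
    (hp : p ∈ stdSimplex ℝ (Fin K)) (hpb : 0 < p b) (hμ : μ ∈ orthant (Scenario b))
    (hq : q ∈ stdSimplex ℝ (Fin K)) (hpZ : ∀ x ∈ Z, p x = 0) (hqZ : ∀ x ∈ Z, q x = 0) :
    q ⬝ᵥ gradPayoff ρ θ b p μ ≤ M * ∑ x ∈ Zᶜ, μ x := by
  have hzero : ∑ x ∈ Z, μ x * derivD ρ θ b p x q = 0 := by
    refine Finset.sum_eq_zero fun x hx => ?_
    rw [derivD_apply, altMean_of_eq_zero_right (hpZ x hx),
      KL_self h.nontrivial_meanSpace (h.mem b), hqZ x hx]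
    ring
  rw [dotProduct_gradPayoff, ← Finset.sum_add_sum_compl Z, hzero, zero_add, mul_comm M,
    Finset.sum_mul]
  exact Finset.sum_le_sum fun x _ => mul_le_mul_of_nonneg_left (h.derivD_le_of_isGradBound hM hp
    (add_pos_of_pos_of_nonneg hpb (hp.1 x)).ne' hq) (hμ x)

lemma kappaMin_mul_sum_le (h : IsBandit ρ θ b) (hμ : μ ∈ orthant (Scenario b))
    (hpZ : ∀ x ∈ Z, p x = 0) :
    kappaMin ρ θ b * ∑ x ∈ Z, μ x ≤ ∑ x ∈ Z, gradPayoff ρ θ b p μ x := by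
  rw [Finset.mul_sum]
  refine Finset.sum_le_sum fun x hx => ?_
  have hκ := kappaMin_le_max_KL (ρ := ρ) (x := x) (right_mem_Icc.2 (h.lt x).le)
  rw [KL_self h.nontrivial_meanSpace (h.mem b), max_eq_left (KL_nonneg _ _)] at hκ
  rw [gradPayoff_scenario, altMean_of_eq_zero_right (hpZ x hx), mul_comm]
  exact mul_le_mul_of_nonneg_left hκ (hμ x)

-- Played arms earn at most `M * ε₀`, whereas some arm of `Z` would earn at least
-- `κ_min (1 - ε₀) / K`.
lemma exists_ne_zero_of_mem_LMOp (h : IsBandit ρ θ b) (hM : IsGradBound ρ θ b M)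
    (hp : p ∈ stdSimplex ℝ (Fin K)) (hpb : 0 < p b) (hμ : μ ∈ stdSimplex ℝ (Scenario b))
    (hq : q ∈ LMOp (payoff ρ θ b) (p, μ)) (hpZ : ∀ x ∈ Z, p x = 0)
    (hμZ : ∑ x ∈ Zᶜ, μ x ≤ eps0 ρ θ b M) : ∃ x ∈ Z, q x ≠ 0 := by
  by_contra! hqZ
  have hκ := h.kappaMin_pos
  have hMpos := h.isGradBound_pos hM
  have hε := h.eps0_pos hM
  have hgrad (x : Scenario b) : gradPayoff ρ θ b p μ x ≤ M * eps0 ρ θ b M :=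
    calc gradPayoff ρ θ b p μ x ≤ q ⬝ᵥ gradPayoff ρ θ b p μ :=
          le_dotProduct_of_mem_LMOp (h.clarkeP_subset_singleton hp.1 hpb) hq x
      _ ≤ M * ∑ x ∈ Zᶜ, μ x :=
          h.dotProduct_gradPayoff_le hM hp hpb hμ.1 (LMOp_subset_stdSimplex hq) hpZ hqZ
      _ ≤ M * eps0 ρ θ b M := by gcongr
  have hcard : (Z.card : ℝ) ≤ K := by
    have hle : (Z.card : ℝ) ≤ Fintype.card (Scenario b) := Nat.cast_le.2 (Finset.card_le_univ Z)
    linarith [card_scenario b]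
  have hhalf : 1 / 2 ≤ ∑ x ∈ Z, μ x := by
    have hε_le : eps0 ρ θ b M ≤ 1 / 2 := min_le_left _ _
    linarith [hμ.2, Finset.sum_add_sum_compl Z μ]
  have hchain : kappaMin ρ θ b * (1 / 2) ≤ kappaMin ρ θ b / 4 :=
    calc kappaMin ρ θ b * (1 / 2) ≤ kappaMin ρ θ b * ∑ x ∈ Z, μ x := by gcongr
      _ ≤ ∑ x ∈ Z, gradPayoff ρ θ b p μ x := h.kappaMin_mul_sum_le hμ.1 hpZ
      _ ≤ Z.card * (M * eps0 ρ θ b M) := by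
          rw [← nsmul_eq_mul]
          exact Finset.sum_le_card_nsmul _ _ _ fun x _ => hgrad x
      _ ≤ K * (M * eps0 ρ θ b M) := by gcongr
      _ ≤ kappaMin ρ θ b / 4 := h.mul_eps0_le hM
  linarith

lemma apply_eq_zero_of_mem_LMOp (h : IsBandit ρ θ b) (hp : p ∈ orthant (Fin K)) (hpb : p b = 0)
    (hx : p x ≠ 0) (hq : q ∈ LMOp (payoff ρ θ b) (p, μ)) : q x = 0 := by
  refine FWSP.apply_eq_zero_of_mem_LMOp (fun f hf => ?_) hq
  rw [h.apply_eq_zero_of_mem_clarkeP hp hpb hx hf]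
  by_contra! hle
  exact (h.kappaMin_pos.trans_le (h.kappaMin_le_sum_of_mem_clarkeP hf)).not_ge
    (Finset.sum_nonpos fun j _ => hle j)

lemma apply_eq_zero_of_mem_LMOmu (h : IsBandit ρ θ b) (hp : p ∈ orthant (Fin K))
    (hpb : 0 < p b) (hx : p x = 0) (hy : 0 < p y) (hν : ν ∈ LMOmu (payoff ρ θ b) (p, μ)) :
    ν y = 0 := by
  refine FWSP.apply_eq_zero_of_mem_LMOmu (x := x) hν ?_
  rw [gradMu_payoff, h.D_of_eq_zero_right hp hx]
  exact h.D_pos hp hpb hy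

end

variable {p : ℝ → Fin K → ℝ} {μ : ℝ → Scenario b → ℝ} {M s t : ℝ}

-- Up to time `t` an arm without weight at `t` has no weight either, so the oracle never picks it,
-- and the generalized gradient of an arm with weight vanishes as long as `b` has none.
lemma best_pos (h : IsBandit ρ θ b) (hsol : IsSolution (payoff ρ θ b) p μ) (ht : 0 < t) :
    0 < p t b := by
  have hp := hsol.isRelaxation_p
  refine (hp.nonneg ht.le b).lt_of_ne' fun hb => ?_
  obtain ⟨s, hst, hpos⟩ := hp.exists_pos_before ht
  obtain ⟨r, hr, hq⟩ := exists_mem_Ioo_of_ae hsol.ae_deriv_p hst.2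
  have hr0 : 0 ≤ r := (hst.1.trans hr.1).le
  obtain ⟨q, hq, hderiv⟩ := hq hr0
  have hq_zero (i : Fin K) : q i = 0 := by
    by_cases hi : p t i = 0
    · exact target_apply_eq_zero hderiv hr fun r' hr' =>
        hp.eq_zero_of_eq_zero (hst.1.trans hr'.1).le hr'.2.le hi
    · have hib : i ≠ b := fun hib => hi (hib ▸ hb)
      have hpi : 0 < p r i :=
        hp.pos_of_pos hst.1.le hr.1.le (hpos i ((hp.nonneg ht.le i).lt_of_ne' hi))
      exact h.apply_eq_zero_of_mem_LMOp (x := ⟨i, hib⟩) (hp.nonneg hr0)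
        (hp.eq_zero_of_eq_zero hr0 hr.2.le hb) hpi.ne' hq
  have hsum := (LMOp_subset_stdSimplex hq).2
  rw [Finset.sum_eq_zero fun i _ => hq_zero i] at hsum
  exact zero_ne_one hsum

-- While some scenario is unplayed, the oracle of `μ` ignores the played ones.
lemma sum_compl_unplayed_le (h : IsBandit ρ θ b) (hsol : IsSolution (payoff ρ θ b) p μ)
    (hs : 0 ≤ s) (hst : s ≤ t) (hne : (unplayed b (p t)).Nonempty) :
    ∑ x ∈ (unplayed b (p s))ᶜ, μ t x ≤ Real.exp (-(t - s)) := by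
  have hp := hsol.isRelaxation_p
  have hμ := hsol.isRelaxation_mu
  obtain ⟨y, hy⟩ := hne
  have hdecay : ∑ x ∈ (unplayed b (p s))ᶜ, μ t x
      ≤ Real.exp (-(t - s)) * ∑ x ∈ (unplayed b (p s))ᶜ, μ s x := by
    refine hμ.sum_le_exp_mul hs hst ?_
    filter_upwards [hsol.ae_deriv_mu] with r hr hmem
    have hr0 : 0 < r := hs.trans_lt hmem.1
    obtain ⟨ν, hν, hderiv⟩ := hr hr0.le
    refine ⟨ν, fun x hx => ?_, hderiv⟩
    rw [Finset.mem_compl, mem_unplayed] at hx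
    exact h.apply_eq_zero_of_mem_LMOmu (hp.nonneg hr0.le) (h.best_pos hsol hr0)
      (hp.eq_zero_of_eq_zero hr0.le hmem.2.le (mem_unplayed.1 hy))
      (hp.pos_of_pos hs hmem.1.le ((hp.nonneg hs x).lt_of_ne' hx)) hν
  refine hdecay.trans (mul_le_of_le_one_right (Real.exp_pos _).le ?_)
  rw [← hμ.sum_eq_one hs]
  exact Finset.sum_le_sum_of_subset_of_nonneg (Finset.subset_univ _) fun x _ _ => hμ.nonneg hs x

lemma sub_le_log_of_unplayed_eq (h : IsBandit ρ θ b) (hM : IsGradBound ρ θ b M)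
    (hsol : IsSolution (payoff ρ θ b) p μ) (hs : 0 ≤ s)
    (heq : unplayed b (p t) = unplayed b (p s)) (hne : (unplayed b (p t)).Nonempty) :
    t - s ≤ Real.log (1 / eps0 ρ θ b M) := by
  by_contra! hlt
  have hp := hsol.isRelaxation_p
  have hlog := h.log_one_div_eps0_nonneg hM
  obtain ⟨r, hr, hq⟩ := exists_mem_Ioo_of_ae hsol.ae_deriv_p (lt_tsub_iff_left.1 hlt)
  have hsr : s ≤ r := by linarith [hr.1]
  obtain ⟨q, hq, hderiv⟩ := hq (hs.trans hsr)
  rcases (hs.trans hsr).eq_or_lt with rfl | hr0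
  · linarith [hr.1]
  have hzero : ∀ x ∈ unplayed b (p t), ∀ r ∈ Icc 0 t, p r x = 0 := fun x hx r hr =>
    hp.eq_zero_of_eq_zero hr.1 hr.2 (mem_unplayed.1 hx)
  have hμ_le : ∑ x ∈ (unplayed b (p t))ᶜ, μ r x ≤ eps0 ρ θ b M := by
    rw [heq]
    refine (h.sum_compl_unplayed_le hsol hs hsr
      (hne.mono (antitoneOn_unplayed hp hr0.le (hr0.trans hr.2).le hr.2.le))).trans ?_
    rw [← Real.le_log_iff_exp_le (h.eps0_pos hM), ← neg_neg (Real.log _), ← Real.log_inv,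
      ← one_div]
    linarith [hr.1]
  obtain ⟨x, hx, hqx⟩ := h.exists_ne_zero_of_mem_LMOp hM (hp.mem_stdSimplex hr0.le)
    (h.best_pos hsol hr0) (hsol.isRelaxation_mu.mem_stdSimplex hr0.le) hq
    (fun x hx => hzero x hx r ⟨hr0.le, hr.2.le⟩) hμ_le
  exact hqx (target_apply_eq_zero hderiv (s := 0) ⟨hr0, hr.2⟩ fun r' hr' =>
    hzero x hx r' (Ioo_subset_Icc_self hr'))

lemma Tstar_pos (h : IsBandit ρ θ b) (hM : IsGradBound ρ θ b M) : 0 < Tstar ρ θ b M :=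
  (mul_nonneg (Nat.cast_nonneg _) (h.log_one_div_eps0_nonneg hM)).trans_lt
    (h.card_mul_log_lt_Tstar M)

lemma pos_of_Tstar_lt (h : IsBandit ρ θ b) (hM : IsGradBound ρ θ b M)
    (hsol : IsSolution (payoff ρ θ b) p μ) (ht : Tstar ρ θ b M < t) (i : Fin K) :
    0 < p t i := by
  have hp := hsol.isRelaxation_p
  have ht0 : 0 < t := (h.Tstar_pos hM).trans ht
  by_cases hi : i = b
  · exact hi ▸ h.best_pos hsol ht0
  refine (hp.nonneg ht0.le i).lt_of_ne' fun hzero => ?_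
  have hle := le_card_mul_of_antitoneOn (antitoneOn_unplayed (b := b) hp)
    (fun s e hs _ heq hne => h.sub_le_log_of_unplayed_eq hM hsol hs heq hne) ht0.le
    ⟨⟨i, hi⟩, mem_unplayed.2 hzero⟩
  exact (hle.trans_lt (h.card_mul_log_lt_Tstar M)).not_gt ht

end IsBandit

end Entry

/-! ### Equilibria -/

section Value

variable {K : ℕ} {ρ : Measure ℝ} {θ : Fin K → ℝ} {b : Fin K}

section Equilibrium

variable {p p' q : Fin K → ℝ} {μ ν : Scenario b → ℝ}

/-- The difference between the values of the best responses of the two players, where the first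
player responds to the linearization of the payoff at `p`. -/
def dualityGap (ρ : Measure ℝ) (θ : Fin K → ℝ) (b : Fin K) (p : Fin K → ℝ)
    (μ : Scenario b → ℝ) : ℝ :=
  (⨆ i, gradPayoff ρ θ b p μ i) - ⨅ x, D ρ θ b p x

lemma dotProduct_sub_dotProduct_le_dualityGap (hq : q ∈ stdSimplex ℝ (Fin K))
    (hν : ν ∈ stdSimplex ℝ (Scenario b)) :
    q ⬝ᵥ gradPayoff ρ θ b p μ - ν ⬝ᵥ D ρ θ b p ≤ dualityGap ρ θ b p μ :=
  sub_le_sub (dotProduct_le_iSup hq) (iInf_le_dotProduct hν)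

namespace IsBandit

lemma dualityGap_le_of_forall_le (h : IsBandit ρ θ b) {u l : ℝ}
    (hu : ∀ i, gradPayoff ρ θ b p μ i ≤ u) (hl : ∀ x, l ≤ D ρ θ b p x) :
    dualityGap ρ θ b p μ ≤ u - l :=
  have := h.nonempty
  have : Nonempty (Fin K) := ⟨b⟩
  sub_le_sub (ciSup_le hu) (le_ciInf hl)

lemma dualityGap_le_of_isGradBound (h : IsBandit ρ θ b) {M : ℝ} (hM : IsGradBound ρ θ b M)
    (hp : p ∈ stdSimplex ℝ (Fin K)) (hb : 0 < p b) (hμ : μ ∈ stdSimplex ℝ (Scenario b)) :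
    dualityGap ρ θ b p μ ≤ M := by
  refine (h.dualityGap_le_of_forall_le (fun i => ?_) (h.D_nonneg hp.1)).trans_eq (sub_zero M)
  exact dotProduct_le_of_forall_le hμ fun x => h.derivD_single_le_of_isGradBound hM hp
    (add_pos_of_pos_of_nonneg hb (hp.1 x)).ne' i

lemma payoff_le_dotProduct (h : IsBandit ρ θ b) (hp : p ∈ orthant (Fin K))
    (hp' : p' ∈ orthant (Fin K)) (hμ : ∀ x, 0 ≤ μ x) :
    payoff ρ θ b (p', μ) ≤ p' ⬝ᵥ gradPayoff ρ θ b p μ := by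
  rw [dotProduct_gradPayoff]
  exact Finset.sum_le_sum fun x _ => mul_le_mul_of_nonneg_left (h.D_le_derivD hp hp' x) (hμ x)

lemma concaveOn_payoff (h : IsBandit ρ θ b) (hμ : ∀ x, 0 ≤ μ x) :
    ConcaveOn ℝ (orthant (Fin K)) fun p => payoff ρ θ b (p, μ) := by
  refine ⟨convex_orthant, fun p hp p' hp' s t hs ht hst => ?_⟩
  have hmem := convex_orthant hp hp' hs ht hst
  simp only [smul_eq_mul]
  rw [h.payoff_eq_dotProduct hmem, add_dotProduct, smul_dotProduct, smul_dotProduct]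
  exact add_le_add (mul_le_mul_of_nonneg_left (h.payoff_le_dotProduct hmem hp hμ) hs)
    (mul_le_mul_of_nonneg_left (h.payoff_le_dotProduct hmem hp' hμ) ht)

lemma upperSemicontinuousOn_payoff (h : IsBandit ρ θ b) (hμ : ∀ x, 0 ≤ μ x) :
    UpperSemicontinuousOn (fun p => payoff ρ θ b (p, μ)) (orthant (Fin K)) := by
  intro p hp c hc
  change payoff ρ θ b (p, μ) < c at hc
  rw [h.payoff_eq_dotProduct hp] at hc
  have hcont : Continuous fun p' : Fin K → ℝ => p' ⬝ᵥ gradPayoff ρ θ b p μ :=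
    continuous_id.dotProduct continuous_const
  filter_upwards [nhdsWithin_le_nhds (hcont.continuousAt.eventually (gt_mem_nhds hc)),
    self_mem_nhdsWithin] with p' hlt hp'
  exact (h.payoff_le_dotProduct hp hp' hμ).trans_lt hlt

lemma exists_isNash (h : IsBandit ρ θ b) :
    ∃ (ps : Fin K → ℝ) (μs : Scenario b → ℝ), IsNash (payoff ρ θ b) ps μs := by
  obtain ⟨x⟩ := h.nonempty
  have hlin (p : Fin K → ℝ) : IsLinearMap ℝ fun μ : Scenario b → ℝ => payoff ρ θ b (p, μ) :=
    ⟨fun μ ν => add_dotProduct μ ν (D ρ θ b p), fun c μ => smul_dotProduct c μ (D ρ θ b p)⟩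
  have hcont (p : Fin K → ℝ) : Continuous fun μ : Scenario b → ℝ => payoff ρ θ b (p, μ) :=
    ((hlin p).mk' _).continuous_of_finiteDimensional
  obtain ⟨μs, hμs, ps, hps, hsaddle⟩ := Sion.exists_isSaddlePointOn
    (X := stdSimplex ℝ (Scenario b)) (Y := stdSimplex ℝ (Fin K))
    (f := fun μ p => payoff ρ θ b (p, μ))
    ⟨_, single_mem_stdSimplex ℝ x⟩ (convex_stdSimplex ℝ _) (isCompact_stdSimplex ℝ _)
    (fun p _ => (hcont p).lowerSemicontinuous.lowerSemicontinuousOn _)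
    (fun p _ => (((hlin p).mk' _).convexOn (convex_stdSimplex ℝ _)).quasiconvexOn)
    (convex_stdSimplex ℝ _) ⟨_, single_mem_stdSimplex ℝ b⟩ (isCompact_stdSimplex ℝ _)
    (fun μ hμ => (h.upperSemicontinuousOn_payoff hμ.1).mono fun _ hp => hp.1)
    (fun μ hμ => ((h.concaveOn_payoff hμ.1).subset (fun _ hp => hp.1)
      (convex_stdSimplex ℝ _)).quasiconcaveOn)
  exact ⟨ps, μs, hps, hμs, fun p hp => hsaddle μs hμs p hp, fun μ hμ => hsaddle μ hμ ps hps⟩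

lemma abs_payoff_sub_le_dualityGap (h : IsBandit ρ θ b) {ps : Fin K → ℝ} {μs : Scenario b → ℝ}
    (hnash : IsNash (payoff ρ θ b) ps μs) (hp : p ∈ stdSimplex ℝ (Fin K))
    (hμ : μ ∈ stdSimplex ℝ (Scenario b)) :
    |payoff ρ θ b (p, μ) - payoff ρ θ b (ps, μs)| ≤ dualityGap ρ θ b p μ := by
  obtain ⟨hps, hμs, hmax, hmin⟩ := hnash
  rw [abs_sub_le_iff]
  constructor
  · calc payoff ρ θ b (p, μ) - payoff ρ θ b (ps, μs)
        ≤ payoff ρ θ b (p, μ) - payoff ρ θ b (p, μs) := sub_le_sub_left (hmax p hp) _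
      _ = p ⬝ᵥ gradPayoff ρ θ b p μ - μs ⬝ᵥ D ρ θ b p := by
          rw [h.payoff_eq_dotProduct hp.1 μ]; rfl
      _ ≤ dualityGap ρ θ b p μ := dotProduct_sub_dotProduct_le_dualityGap hp hμs
  · calc payoff ρ θ b (ps, μs) - payoff ρ θ b (p, μ)
        ≤ payoff ρ θ b (ps, μ) - payoff ρ θ b (p, μ) := sub_le_sub_right (hmin μ hμ) _
      _ ≤ ps ⬝ᵥ gradPayoff ρ θ b p μ - μ ⬝ᵥ D ρ θ b p :=
          sub_le_sub_right (h.payoff_le_dotProduct hp.1 hps.1 hμ.1) _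
      _ ≤ dualityGap ρ θ b p μ := dotProduct_sub_dotProduct_le_dualityGap hps hμ

end IsBandit

end Equilibrium

/-! ### Decay of the duality gap -/

section Decay

variable {p : ℝ → Fin K → ℝ} {μ : ℝ → Scenario b → ℝ} {q v : Fin K → ℝ} {ν : Scenario b → ℝ}
  {x : Scenario b} {r s t : ℝ}

lemma hasDerivAt_altMean (hp : HasDerivAt p v r) (hne : p r b + p r x ≠ 0) :
    HasDerivAt (fun r => altMean θ b (p r) x)
      ((v b * (θ b - altMean θ b (p r) x) + v x * (θ x - altMean θ b (p r) x))
        / (p r b + p r x)) r := by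
  have hb := hasDerivAt_pi.1 hp b
  have hx := hasDerivAt_pi.1 hp x
  have hquot := ((hb.mul_const (θ b)).fun_add (hx.mul_const (θ x))).fun_div (hb.fun_add hx) hne
  refine (hquot.congr_of_eventuallyEq ?_).congr_deriv ?_
  · filter_upwards [(hb.fun_add hx).continuousAt.eventually_ne hne] with r' hr'
      using if_neg hr'
  · rw [altMean, if_neg hne]
    field_simp
    ring

lemma absolutelyContinuousOnInterval_altMean (hp : AbsolutelyContinuousOnInterval p s t)
    (hne : ∀ r ∈ uIcc s t, p r b + p r x ≠ 0) :
    AbsolutelyContinuousOnInterval (fun r => altMean θ b (p r) x) s t := by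
  have hb := absolutelyContinuousOnInterval_apply hp b
  have hx := absolutelyContinuousOnInterval_apply hp x.1
  have hinv : AbsolutelyContinuousOnInterval (fun r => (p r b + p r x)⁻¹) s t := by
    refine absolutelyContinuousOnInterval_comp (g := Inv.inv) (g' := fun y => -(y ^ 2)⁻¹)
      (hb.fun_add hx) (fun r hr => hasDerivAt_inv (hne r hr)) (ContinuousOn.neg ?_)
    exact ((continuous_pow 2).continuousOn).inv₀
      (forall_mem_image.2 fun r hr => pow_ne_zero 2 (hne r hr))
  have hquot := ((hb.const_mul (θ b)).fun_add (hx.const_mul (θ x))).fun_mul hinv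
  refine absolutelyContinuousOnInterval_of_dist_le (C := 1) (fun _ : Unit => hquot)
    fun r hr r' hr' => ?_
  simp [altMean, hne r hr, hne r' hr', div_eq_mul_inv, mul_comm]

namespace IsBandit

lemma absolutelyContinuousOnInterval_derivD (h : IsBandit ρ θ b)
    (hp : AbsolutelyContinuousOnInterval p s t) (hpo : ∀ r ∈ uIcc s t, p r ∈ orthant (Fin K))
    (hne : ∀ r ∈ uIcc s t, p r b + p r x ≠ 0) {d : ℝ → Fin K → ℝ}
    (hd : AbsolutelyContinuousOnInterval d s t) :
    AbsolutelyContinuousOnInterval (fun r => derivD ρ θ b (p r) x (d r)) s t := by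
  have hmem (r : ℝ) (hr : r ∈ uIcc s t) := h.altMean_mem_meanSpace (hpo r hr) x
  have hKL (i : Fin K) :
      AbsolutelyContinuousOnInterval (fun r => KL ρ (θ i) (altMean θ b (p r) x)) s t := by
    refine absolutelyContinuousOnInterval_comp (g' := fun l => (l - θ i) * fisherInfo ρ l)
      (absolutelyContinuousOnInterval_altMean hp hne)
      (fun r hr => hasDerivAt_KL h.nontrivial_meanSpace (h.mem i) (hmem r hr)) ?_
    exact ((continuous_sub_right (θ i)).continuousOn.mul
      (continuousOn_fisherInfo h.nontrivial_meanSpace)).mono (image_subset_iff.2 hmem)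
  simp only [derivD_apply]
  exact ((absolutelyContinuousOnInterval_apply hd b).fun_mul (hKL b)).fun_add
    ((absolutelyContinuousOnInterval_apply hd x.1).fun_mul (hKL x))

lemma absolutelyContinuousOnInterval_dualityGap (h : IsBandit ρ θ b)
    (hp : AbsolutelyContinuousOnInterval p s t) (hμ : AbsolutelyContinuousOnInterval μ s t)
    (hpo : ∀ r ∈ uIcc s t, p r ∈ orthant (Fin K)) (hb : ∀ r ∈ uIcc s t, 0 < p r b) :
    AbsolutelyContinuousOnInterval (fun r => dualityGap ρ θ b (p r) (μ r)) s t := by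
  have := h.nonempty
  have : Nonempty (Fin K) := ⟨b⟩
  have hne (x : Scenario b) (r : ℝ) (hr : r ∈ uIcc s t) : p r b + p r x ≠ 0 :=
    (add_pos_of_pos_of_nonneg (hb r hr) (hpo r hr x)).ne'
  have hgrad (i : Fin K) :
      AbsolutelyContinuousOnInterval (fun r => gradPayoff ρ θ b (p r) (μ r) i) s t :=
    absolutelyContinuousOnInterval_sum fun x _ =>
      (absolutelyContinuousOnInterval_apply hμ x).fun_mul <|
        h.absolutelyContinuousOnInterval_derivD hp hpo (hne x)
          (absolutelyContinuousOnInterval_const _)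
  have hD (x : Scenario b) : AbsolutelyContinuousOnInterval (fun r => D ρ θ b (p r) x) s t := by
    refine absolutelyContinuousOnInterval_of_dist_le (C := 1)
      (fun _ : Unit => h.absolutelyContinuousOnInterval_derivD hp hpo (hne x) hp)
      fun r hr r' hr' => ?_
    simp [h.D_eq_derivD (hpo r hr), h.D_eq_derivD (hpo r' hr')]
  exact (absolutelyContinuousOnInterval_iSup hgrad).fun_sub
    (absolutelyContinuousOnInterval_iInf hD)

lemma hasDerivAt_D (h : IsBandit ρ θ b) (hp : HasDerivAt p v r)
    (hpo : ∀ᶠ r in 𝓝 r, p r ∈ orthant (Fin K)) (hne : p r b + p r x ≠ 0) :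
    HasDerivAt (fun r => D ρ θ b (p r) x) (derivD ρ θ b (p r) x v) r :=
  (h.hasFDerivWithinAt_D hpo.self_of_nhds hne).comp_hasDerivAt r hp hpo

-- The Hessian of `D · x` at `p` is negative semidefinite and, by homogeneity, annihilates `p`.
lemma exists_hasDerivAt_derivD (h : IsBandit ρ θ b) (hp : HasDerivAt p (q - p r) r)
    (hpo : p r ∈ orthant (Fin K)) (hne : p r b + p r x ≠ 0) :
    ∃ c ≤ 0, HasDerivAt (fun r => derivD ρ θ b (p r) x q) c r := by
  have hmem := h.altMean_mem_meanSpace hpo x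
  have hKL (i : Fin K) := HasDerivAt.comp (h₂ := KL ρ (θ i)) r
    (hasDerivAt_KL h.nontrivial_meanSpace (h.mem i) hmem) (hasDerivAt_altMean hp hne)
  simp only [derivD_apply]
  refine ⟨_, ?_, ((hKL b).const_mul (q b)).fun_add ((hKL x).const_mul (q x))⟩
  have hvanish := add_mul_altMean (θ := θ) hpo x
  have hpos := add_pos_of_mem_orthant hpo hne
  have hinfo := fisherInfo_pos h.nontrivial_meanSpace hmem
  simp only [Pi.sub_apply]
  set l := altMean θ b (p r) x
  set u := q b * (θ b - l) + q x * (θ x - l)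
  have hnum : (q b - p r b) * (θ b - l) + (q x - p r x) * (θ x - l) = u := by
    linear_combination hvanish
  rw [hnum]
  calc q b * ((l - θ b) * fisherInfo ρ l * (u / (p r b + p r x)))
        + q x * ((l - θ x) * fisherInfo ρ l * (u / (p r b + p r x)))
      = -(fisherInfo ρ l * (u ^ 2 / (p r b + p r x))) := by ring
    _ ≤ 0 := neg_nonpos.2 (by positivity)

lemma exists_hasDerivAt_responseGap (h : IsBandit ρ θ b) (hp : HasDerivAt p (q - p r) r)
    (hμ : HasDerivAt μ (ν - μ r) r) (hpo : ∀ᶠ r in 𝓝 r, p r ∈ orthant (Fin K))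
    (hb : 0 < p r b) (hμ0 : μ r ∈ orthant (Scenario b)) :
    ∃ c ≤ -(q ⬝ᵥ gradPayoff ρ θ b (p r) (μ r) - ν ⬝ᵥ D ρ θ b (p r)),
      HasDerivAt (fun r => q ⬝ᵥ gradPayoff ρ θ b (p r) (μ r) - ν ⬝ᵥ D ρ θ b (p r)) c r := by
  have hpo' := hpo.self_of_nhds
  have hne (x : Scenario b) : p r b + p r x ≠ 0 := (add_pos_of_pos_of_nonneg hb (hpo' x)).ne'
  choose c hc hderiv using fun x => h.exists_hasDerivAt_derivD hp hpo' (hne x)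
  simp only [dotProduct_gradPayoff]
  simp only [dotProduct, ← Finset.sum_sub_distrib]
  refine ⟨_, ?_, HasDerivAt.fun_sum (u := Finset.univ) fun x _ =>
    ((hasDerivAt_pi.1 hμ x).fun_mul (hderiv x)).fun_sub
      ((h.hasDerivAt_D hp hpo (hne x)).const_mul (ν x))⟩
  rw [← Finset.sum_neg_distrib]
  refine Finset.sum_le_sum fun x _ => ?_
  rw [map_sub, ← h.D_eq_derivD hpo' x, Pi.sub_apply]
  linarith [mul_nonpos_of_nonneg_of_nonpos (hμ0 x) (hc x)]

lemma dualityGap_le_exp_mul (h : IsBandit ρ θ b) (hsol : IsSolution (payoff ρ θ b) p μ)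
    (hs : 0 < s) (hst : s ≤ t) :
    dualityGap ρ θ b (p t) (μ t) ≤ Real.exp (-(t - s)) * dualityGap ρ θ b (p s) (μ s) := by
  have hp := hsol.isRelaxation_p
  have hpos (r : ℝ) (hr : r ∈ uIcc s t) : 0 < r :=
    hs.trans_le ((uIcc_of_le hst ▸ hr : r ∈ Icc s t).1)
  refine le_exp_mul_of_touching_deriv_le (V := fun r => dualityGap ρ θ b (p r) (μ r)) hst
    (h.absolutelyContinuousOnInterval_dualityGap (hp.ac_Icc hs.le hst)
      (hsol.isRelaxation_mu.ac_Icc hs.le hst) (fun r hr => hp.nonneg (hpos r hr).le)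
      fun r hr => h.best_pos hsol (hpos r hr)) ?_
  filter_upwards [hsol.ae_deriv_p, hsol.ae_deriv_mu] with r hrp hrμ hmem
  have hr : 0 < r := hs.trans hmem.1
  obtain ⟨q, hq, hderiv_p⟩ := hrp hr.le
  obtain ⟨ν, hν, hderiv_mu⟩ := hrμ hr.le
  have hbest := h.best_pos hsol hr
  have hpo : ∀ᶠ r in 𝓝 r, p r ∈ orthant (Fin K) := by
    filter_upwards [lt_mem_nhds hr] with r' hr' using hp.nonneg hr'.le
  have hν_le := dotProduct_le_of_mem_LMOmu hν
  rw [gradMu_payoff] at hν_le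
  have hgap : dualityGap ρ θ b (p r) (μ r)
      = q ⬝ᵥ gradPayoff ρ θ b (p r) (μ r) - ν ⬝ᵥ D ρ θ b (p r) :=
    le_antisymm (h.dualityGap_le_of_forall_le (le_dotProduct_of_mem_LMOp
      (h.clarkeP_subset_singleton hpo.self_of_nhds hbest) hq) hν_le)
      (dotProduct_sub_dotProduct_le_dualityGap (LMOp_subset_stdSimplex hq) hν.1)
  refine ⟨_, fun r' => dotProduct_sub_dotProduct_le_dualityGap (LMOp_subset_stdSimplex hq) hν.1,
    hgap.symm, ?_⟩
  rw [hgap]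
  exact h.exists_hasDerivAt_responseGap hderiv_p hderiv_mu hpo hbest
    (hsol.isRelaxation_mu.nonneg hr.le)

lemma abs_payoff_sub_le (h : IsBandit ρ θ b) {M : ℝ} (hM : IsGradBound ρ θ b M)
    (hsol : IsSolution (payoff ρ θ b) p μ) {ps : Fin K → ℝ} {μs : Scenario b → ℝ}
    (hnash : IsNash (payoff ρ θ b) ps μs) (ht : 1 ≤ t) :
    |payoff ρ θ b (p t, μ t) - payoff ρ θ b (ps, μs)| ≤ Real.exp (-(t - 1)) * M := by
  have hp := hsol.isRelaxation_p
  have hμ := hsol.isRelaxation_mu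
  have ht0 : 0 ≤ t := zero_le_one.trans ht
  calc |payoff ρ θ b (p t, μ t) - payoff ρ θ b (ps, μs)|
      ≤ dualityGap ρ θ b (p t) (μ t) :=
        h.abs_payoff_sub_le_dualityGap hnash (hp.mem_stdSimplex ht0) (hμ.mem_stdSimplex ht0)
    _ ≤ Real.exp (-(t - 1)) * dualityGap ρ θ b (p 1) (μ 1) :=
        h.dualityGap_le_exp_mul hsol one_pos ht
    _ ≤ Real.exp (-(t - 1)) * M := by
        gcongr
        exact h.dualityGap_le_of_isGradBound hM (hp.mem_stdSimplex zero_le_one)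
          (h.best_pos hsol one_pos) (hμ.mem_stdSimplex zero_le_one)

lemma exists_forall_abs_payoff_sub_le (h : IsBandit ρ θ b) {ps : Fin K → ℝ}
    {μs : Scenario b → ℝ} (hnash : IsNash (payoff ρ θ b) ps μs) {ε : ℝ} (hε : 0 < ε) :
    ∃ T : ℝ, ∀ (p : ℝ → Fin K → ℝ) (μ : ℝ → Scenario b → ℝ), IsSolution (payoff ρ θ b) p μ →
      ∀ t : ℝ, T ≤ t → |payoff ρ θ b (p t, μ t) - payoff ρ θ b (ps, μs)| ≤ ε := by
  obtain ⟨M, hM⟩ := h.exists_isGradBound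
  have hMpos := h.isGradBound_pos hM
  refine ⟨1 + M / ε, fun p μ hsol t ht => ?_⟩
  have ht1 : 1 ≤ t := (le_add_of_nonneg_right (by positivity)).trans ht
  have hexp : M / ε ≤ Real.exp (t - 1) := by linarith [Real.add_one_le_exp (t - 1)]
  refine (h.abs_payoff_sub_le hM hsol hnash ht1).trans ?_
  rw [Real.exp_neg, inv_mul_le_iff₀ (Real.exp_pos _)]
  exact (div_le_iff₀ hε).1 hexp

end IsBandit

end Decay

end Value

end FWSP

end

theorem theorem4 {K : ℕ} (hK : 2 ≤ K) (ρ : MeasureTheory.Measure ℝ) (θ : Fin K → ℝ)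
    (hθ : ∀ i, θ i ∈ FWSP.meanSpace ρ) (b : Fin K) (hb : ∀ x, x ≠ b → θ x < θ b) :
    (∃ M : ℝ, FWSP.IsGradBound ρ θ b M) ∧
    (∀ M : ℝ, FWSP.IsGradBound ρ θ b M →
      ∀ (p : ℝ → Fin K → ℝ) (μ : ℝ → FWSP.Scenario b → ℝ),
        FWSP.IsSolution (FWSP.payoff ρ θ b) p μ →
        ∀ t : ℝ, FWSP.Tstar ρ θ b M < t →
          p t ∈ intrinsicInterior ℝ (stdSimplex ℝ (Fin K)) ∧
          DifferentiableAt ℝ (FWSP.payoff ρ θ b) (p t, μ t)) ∧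
    ∃ (ps : Fin K → ℝ) (μs : FWSP.Scenario b → ℝ),
      FWSP.IsNash (FWSP.payoff ρ θ b) ps μs ∧
      ∀ ε : ℝ, 0 < ε → ∃ T : ℝ,
        ∀ (p : ℝ → Fin K → ℝ) (μ : ℝ → FWSP.Scenario b → ℝ),
          FWSP.IsSolution (FWSP.payoff ρ θ b) p μ →
          ∀ t : ℝ, T ≤ t →
            |FWSP.payoff ρ θ b (p t, μ t) - FWSP.payoff ρ θ b (ps, μs)| ≤ ε := by
  have h : FWSP.IsBandit ρ θ b := ⟨hK, hθ, fun x => hb x x.2⟩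
  refine ⟨h.exists_isGradBound, fun M hM p μ hsol t ht => ?_, ?_⟩
  · have hpos := h.pos_of_Tstar_lt hM hsol ht
    have ht0 := ((h.Tstar_pos hM).trans ht).le
    exact ⟨FWSP.mem_intrinsicInterior_stdSimplex (hsol.isRelaxation_p.mem_stdSimplex ht0) hpos,
      h.differentiableAt_payoff hpos⟩
  · obtain ⟨ps, μs, hnash⟩ := h.exists_isNash
    exact ⟨ps, μs, hnash, fun ε hε => h.exists_forall_abs_payoff_sub_le hnash hε⟩
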